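/- Let $N\ge 1$ be an integer, let $m,\mu\ge 0$, $\nu\in\mathbb{R}$, $p>1$, $R>0$ be real numbers with $\delta:=(\mu-1)^2-4\nu^2\ge 0$, and put $\phi_m(t):=\frac{t^{1+m}}{1+m}$ and, for real $n$, $p_T(n,m):=1+\frac{2}{(1+m)(n-1)-m}$. Consider the Cauchy problem $$u_{tt}-t^{2m}\Delta u+\frac{\mu}{t}u_t+\frac{\nu^2}{t^2}u=|u_t|^p\ \text{ in }\mathbb{R}^N\times[1,\infty),\qquad u(x,1)=\varepsilon u_0(x),\quad u_t(x,1)=\varepsilon u_1(x). \qquad (E)$$ For $1<T\le\infty$, an energy solution of (E) on $[1,T)$ is a real function $u\in C([1,T),H^1(\mathbb{R}^N))\cap C^1([1,T),L^2(\mathbb{R}^N))$ with $u_t\in L^p_{loc}((1,T)\times\mathbb{R}^N)$ and $u(\cdot,1)=\varepsilon u_0$ such that, for every $\Phi\in C_0^\infty(\mathbb{R}^N\times[1,T))$ and every $t\in[1,T)$, the integral of $|u_t|^p\Phi$ over $(1,t)\times\mathbb{R}^N$ converges absolutely and $$t^\mu\!\int_{\mathbb{R}^N}\! u_t\Phi(x,t)\,dx-\varepsilon\!\int_{\mathbb{R}^N}\!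 u_1(x)\Phi(x,1)\,dx-\int_1^t\! s^\mu\!\int_{\mathbb{R}^N}\! u_t\Phi_t\,dx\,ds-\int_1^t\! s^{2m+\mu}\!\int_{\mathbb{R}^N}\! u\,\Delta\Phi\,dx\,ds+\int_1^t\! \nu^2s^{\mu-2}\!\int_{\mathbb{R}^N}\! u\,\Phi\,dx\,ds=\int_1^t\! s^\mu\!\int_{\mathbb{R}^N}\!|u_t|^p\Phi\,dx\,ds .$$ Let $u_0\in H^1(\mathbb{R}^N)$ and $u_1\in L^2(\mathbb{R}^N)$ be nonnegative, supported in $\{|x|\le R\}$ and not both identically zero, and suppose that $\frac{\mu-1-\sqrt{\delta}}{2}u_0(x)+u_1(x)>0$ for almost every $x$ at which $u_0$ and $u_1$ do not both vanish. Let the lifespan $T_\varepsilon$ be the supremum of all $T\in(1,\infty]$ for which (E) has an energy solution $u$ on $[1,T)$ with $$\operatorname{supp}(u)\subset\{(x,t):|x|\le R+\phi_m(t)-\phi_m(1)\}.$$ Then there are constants $\varepsilon_0>0$ and $C>0$, depending on $u_0,u_1,N,R,p,m,\mu,\nu$ but not on $\varepsilon$, such that the following holds for all $0<\varepsilon\le\varepsilon_0$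 (so that in each of these cases every such solution blows up in finite time, that is, it cannot be continued beyond the stated bound). If $N\ge2$, then $$T_\varepsilon\le\begin{cases} C\,\varepsilon^{-\frac{2(p-1)}{2-((1+m)(N-1)-m+\mu)(p-1)}} & \text{if } 1<p<p_T\!\left(N+\tfrac{\mu}{m+1},m\right),\\[1mm] \exp\!\left(C\varepsilon^{-(p-1)}\right) & \text{if } p=p_T\!\left(N+\tfrac{\mu}{m+1},m\right).\end{cases}$$ If $N=1$, then $$T_\varepsilon\le\begin{cases} C\,\varepsilon^{-\frac{2(p-1)}{2-(\mu-m)(p-1)}} & \text{if } \mu\le m,\ \text{ or if } \mu>m \text{ and } 1<p<1+\frac{2}{\mu-m},\\[1mm] \exp\!\left(C\varepsilon^{-(p-1)}\right) & \text{if } \mu>m \text{ and } p=1+\frac{2}{\mu-m}.\end{cases}$$ -/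

import Mathlib

open MeasureTheory Set
open scoped ContDiff ENNReal

noncomputable section

namespace TricomiWave

/-- Euclidean space `ℝ^N`. -/
abbrev Space (N : ℕ) : Type := EuclideanSpace ℝ (Fin N)

/-- The real Lebesgue space `L²(ℝ^N)`. -/
abbrev L2 (N : ℕ) : Type := Lp ℝ 2 (volume : Measure (Space N))

/-- `g ∈ L²` is the weak partial derivative in the `i`-th direction of `f ∈ L²`. -/
def IsWeakPartial {N : ℕ} (i : Fin N) (f g : L2 N) : Prop :=
  ∀ φ : Space N → ℝ, ContDiff ℝ ∞ φ → HasCompactSupport φ →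
    ∫ x, f x * fderiv ℝ φ x (EuclideanSpace.single i 1) = -∫ x, g x * φ x

/-- `f ∈ H¹(ℝ^N)`: `f ∈ L²` and all its first order weak derivatives are in `L²`. -/
def MemH1 {N : ℕ} (f : L2 N) : Prop :=
  ∀ i : Fin N, ∃ g : L2 N, IsWeakPartial i f g

/-- The time interval `[1, T)`, where `T` may be `+∞`. -/
def timeInterval (T : EReal) : Set ℝ := {t | 1 ≤ t ∧ (t : EReal) < T}

/-- `u ∈ C([1,T), H¹(ℝ^N))`: `u` and its weak first order derivatives exist at every time of
`[1,T)` and depend continuously on time in the norm of `L²(ℝ^N)`. -/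
def ContinuousInH1 {N : ℕ} (T : EReal) (u : ℝ → L2 N) : Prop :=
  ContinuousOn u (timeInterval T) ∧
    ∀ i : Fin N, ∃ g : ℝ → L2 N, ContinuousOn g (timeInterval T) ∧
      ∀ t ∈ timeInterval T, IsWeakPartial i (u t) (g t)

/-- The time derivative `u_t` on `[1,T)` as a derivative of an `L²(ℝ^N)`-valued function
(one-sided at `t = 1`). -/
def timeDeriv {N : ℕ} (T : EReal) (u : ℝ → L2 N) (t : ℝ) : L2 N :=
  derivWithin u (timeInterval T) t

/-- `v ∈ L^p_loc((1,T) × ℝ^N)` for a curve `v` in `L²(ℝ^N)`: the space-time integral of `|v|^p` over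
`[a,b] × {|x| ≤ r}` is finite whenever `1 < a` and `b < T`. -/
def LocLp {N : ℕ} (p : ℝ) (T : EReal) (v : ℝ → L2 N) : Prop :=
  ∀ a b r : ℝ, 1 < a → (b : EReal) < T →
    ∫⁻ s in Icc a b, ∫⁻ x in Metric.closedBall (0 : Space N) r,
      ENNReal.ofReal (|v s x| ^ p) < ⊤

/-- Test functions `Φ ∈ C_0^∞(ℝ^N × [1,T))`, given as restrictions to `t ≥ 1` of smooth compactly
supported functions on `ℝ × ℝ^N` whose support lies in `{t < T}`. Time is the first variable;
the support may meet `{t = 1}`. -/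
structure IsTest {N : ℕ} (T : EReal) (Φ : ℝ × Space N → ℝ) : Prop where
  smooth : ContDiff ℝ ∞ Φ
  compactSupport : HasCompactSupport Φ
  support_lt : ∀ z ∈ tsupport Φ, (z.1 : EReal) < T

/-- `Φ_t (t, x)`. -/
def testDt {N : ℕ} (Φ : ℝ × Space N → ℝ) (t : ℝ) (x : Space N) : ℝ :=
  deriv (fun s => Φ (s, x)) t

/-- `Δ Φ (t, x)`, the Laplacian in the space variable. -/
def testLaplacian {N : ℕ} (Φ : ℝ × Space N → ℝ) (t : ℝ) (x : Space N) : ℝ :=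
  Laplacian.laplacian (fun y => Φ (t, y)) x

/-- `u` is an energy solution on `[1,T)` of
`u_tt - t^(2m) Δu + (μ/t) u_t + (ν²/t²) u = |u_t|^p`, `u(1) = ε u₀`, `u_t(1) = ε u₁`. The weak
identity is the one tested against `t^μ Φ`; the space-time integral of `|u_t|^p Φ` is required to
converge absolutely. -/
structure IsEnergySolution {N : ℕ} (m μ ν p ε : ℝ) (u₀ u₁ : L2 N) (T : EReal)
    (u : ℝ → L2 N) : Prop where
  continuous_H1 : ContinuousInH1 T u
  contDiff_L2 : ContDiffOn ℝ 1 u (timeInterval T)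
  locLp : LocLp p T (timeDeriv T u)
  initial : u 1 = ε • u₀
  integrable : ∀ Φ : ℝ × Space N → ℝ, IsTest T Φ → ∀ t ∈ timeInterval T,
    ∫⁻ s in Ioc 1 t, ∫⁻ x, ENNReal.ofReal (|timeDeriv T u s x| ^ p * |Φ (s, x)|) < ⊤
  weak : ∀ Φ : ℝ × Space N → ℝ, IsTest T Φ → ∀ t ∈ timeInterval T,
    t ^ μ * (∫ x, timeDeriv T u t x * Φ (t, x))
      - ε * (∫ x, u₁ x * Φ (1, x))
      - (∫ s in (1 : ℝ)..t, s ^ μ * ∫ x, timeDeriv T u s x * testDt Φ s x)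
      - (∫ s in (1 : ℝ)..t, s ^ (2 * m) * s ^ μ * ∫ x, u s x * testLaplacian Φ s x)
      + (∫ s in (1 : ℝ)..t, ν ^ 2 * s ^ μ / s ^ 2 * ∫ x, u s x * Φ (s, x))
    = ∫ s in (1 : ℝ)..t, s ^ μ * ∫ x, |timeDeriv T u s x| ^ p * Φ (s, x)

/-- `φ_m(t) = t^(1+m) / (1+m)`. -/
def phi (m t : ℝ) : ℝ := t ^ (1 + m) / (1 + m)

/-- `supp u ⊆ {(x,t) : |x| ≤ R + φ_m(t) - φ_m(1)}`. -/
def SupportedInCone {N : ℕ} (m R : ℝ) (T : EReal) (u : ℝ → L2 N) : Prop :=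
  ∀ t ∈ timeInterval T, ∀ᵐ x : Space N, R + phi m t - phi m 1 < ‖x‖ → u t x = 0

/-- The lifespan `T_ε ∈ [-∞, +∞]`: the supremum of all `T ∈ (1, +∞]` for which there is an energy
solution on `[1,T)` with support in the cone. It is `+∞` if there is a global solution. -/
def lifespan {N : ℕ} (m μ ν p R ε : ℝ) (u₀ u₁ : L2 N) : EReal :=
  sSup {T : EReal | 1 < T ∧ ∃ u : ℝ → L2 N,
    IsEnergySolution m μ ν p ε u₀ u₁ T u ∧ SupportedInCone m R T u}

/-- `δ = (μ - 1)² - 4ν²`. -/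
def discr (μ ν : ℝ) : ℝ := (μ - 1) ^ 2 - 4 * ν ^ 2

/-- `p_T(n, m) = 1 + 2 / ((1+m)(n-1) - m)`, for a real "dimension" `n`. -/
def pT (n m : ℝ) : ℝ := 1 + 2 / ((1 + m) * (n - 1) - m)

/-- The assumptions on the data: `u₀ ∈ H¹`, `u₁ ∈ L²` are nonnegative, supported in the ball of
radius `R`, not both zero, and `(μ - 1 - √δ)/2 * u₀ + u₁ > 0` at almost every point at which the
data do not both vanish. -/
structure AdmissibleData {N : ℕ} (μ ν R : ℝ) (u₀ u₁ : L2 N) : Prop where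
  memH1 : MemH1 u₀
  nonneg₀ : ∀ᵐ x : Space N, 0 ≤ u₀ x
  nonneg₁ : ∀ᵐ x : Space N, 0 ≤ u₁ x
  supp₀ : ∀ᵐ x : Space N, R < ‖x‖ → u₀ x = 0
  supp₁ : ∀ᵐ x : Space N, R < ‖x‖ → u₁ x = 0
  nontrivial : u₀ ≠ 0 ∨ u₁ ≠ 0
  pos : ∀ᵐ x : Space N, (u₀ x ≠ 0 ∨ u₁ x ≠ 0) →
    0 < (μ - 1 - √(discr μ ν)) / 2 * u₀ x + u₁ x

end TricomiWave

end

/-! Average the solution against the plane wave `exp (x i₀)`, a positive eigenfunction of the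
Laplacian with eigenvalue 1. The averages `w` of `u` and `g = w'` of `u_t` satisfy `w'' + (μ/t) w' +
(ν²/t² - t^(2m)) w = f` with `f ≥ 0`, where `f` is the average of `|u_t|^p` (`exists_dampedODE`).
Finite propagation speed and Hölder give `g^p ≤ f M^(p-1)` when `g ≥ 0`, with `M` the mass of the
plane wave on the cone section, at most a constant times `t^((1+m)(N-1)/2) exp (phi m t)`.

The equation is treated by factoring its operator. If `E' = b E`, the derivative of `E t^μ (w' - b
w)` is `E t^μ f` plus `E t^μ w` times the defect in the Riccati equation for `b`. For a Riccati
subsolution and `w ≥ 0` this quantity therefore increases at least as fast as the weighted source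
(`DampedODE.factor`).

Two choices of `b` are used. A growing one, a small perturbation of the Euler exponent, turns the
sign condition on the data into `w ≥ 0` and, for large times, `w' ≥ (θ/2) t^m w`
(`exists_positivity`). A decaying one, the WKB approximation `-t^m - (m+μ)/(2t)` with a correction
`q/t²`, produces `H = E t^μ (w' - b w)`, which is comparable to `E t^μ w'`. In `E t^μ M` the
exponentials cancel, leaving a power of `t`, so `H` satisfies an integrated form of `H' ≥ k H^p
t^(-γ)` with `γ = ((1+m)(N-1) - m + μ)(p-1)/2` and `H ≥ c₃ ε` at a time `T₀` independent of `ε`.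

Comparison bounds the integral of `t^(-γ)` over the existence interval by `K ε^(-(p-1))`
(`exists_integral_rpow_neg_le`). For `γ < 1` this integral grows like a power, for `γ = 1` like a
logarithm, which gives the two kinds of lifespan bound. -/

namespace TricomiWave

/-! ### Factorization of the damped equation -/

/-- Integration by parts of a `C¹` function against a primitive of an integrable function. -/
theorem integral_by_parts_primitive {a c y₀ : ℝ} (hac : a ≤ c) {y r E E' : ℝ → ℝ}
    (hr : IntervalIntegrable r volume a c)
    (hy : ∀ t ∈ Icc a c, y t = y₀ + ∫ s in a..t, r s)
    (hE : ∀ t ∈ Icc a c, HasDerivAt E (E' t) t) (hE' : ContinuousOn E' (Icc a c)) :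
    E c * y c - E a * y a = ∫ s in a..c, (E' s * y s + E s * r s) := by
  rcases hac.eq_or_lt with rfl | h
  · simp
  have hI : uIcc a c = Icc a c := uIcc_of_le hac
  -- The source is only integrable in time, so `y` is absolutely continuous but need not be
  -- differentiable everywhere.
  have hy' : AbsolutelyContinuousOnInterval (fun t => y₀ + ∫ s in a..t, r s) a c :=
    AbsolutelyContinuousOnInterval.fun_add
      ((contDiffOn_const (c := y₀)).absolutelyContinuousOnInterval)
      (hr.absolutelyContinuousOnInterval_intervalIntegral (by simp))
  have hE'' : AbsolutelyContinuousOnInterval E a c := by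
    have h1 : IntervalIntegrable E' volume a c := ContinuousOn.intervalIntegrable (hI ▸ hE')
    refine ContDiffOn.absolutelyContinuousOnInterval ?_
    rw [hI]
    rw [show (1 : WithTop ℕ∞) = 0 + 1 by simp,
      contDiffOn_succ_iff_derivWithin (uniqueDiffOn_Icc h)]
    refine ⟨fun t ht => (hE t ht).differentiableAt.differentiableWithinAt, by simp, ?_⟩
    rw [contDiffOn_zero]
    refine hE'.congr fun t ht => ?_
    exact ((hE t ht).hasDerivWithinAt).derivWithin (uniqueDiffOn_Icc h t ht)
  have key := hE''.integral_deriv_mul_eq_sub hy'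
  rw [hy c ⟨hac, le_rfl⟩, hy a ⟨le_rfl, hac⟩, ← key]
  refine intervalIntegral.integral_congr_ae ?_
  filter_upwards [hr.ae_hasDerivAt_integral] with x hx hxm
  have hx1 : x ∈ uIcc a c := uIoc_subset_uIcc hxm
  have h2 := ((hx hx1 a (by simp)).const_add y₀).deriv
  rw [hI] at hx1
  rw [h2, (hE x hx1).deriv, hy x hx1]

/-- `w` solves `w'' + (μ/t) w' + (ν²/t² - t^(2m)) w = f` on `[1, t₁]` in integrated form, with
`w' = g` and a nonnegative integrable source `f`. -/
structure DampedODE (m μ ν t₁ : ℝ) (w g f : ℝ → ℝ) : Prop where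
  one_le : 1 ≤ t₁
  cont_w : ContinuousOn w (Icc 1 t₁)
  cont_g : ContinuousOn g (Icc 1 t₁)
  deriv_w : ∀ t ∈ Ioo 1 t₁, HasDerivAt w (g t) t
  source_nonneg : ∀ t, 0 ≤ f t
  source_integrable : IntervalIntegrable (fun s => s ^ μ * f s) volume 1 t₁
  eq : ∀ t ∈ Icc 1 t₁, t ^ μ * g t = g 1 +
    ∫ s in (1 : ℝ)..t, ((s ^ (2 * m) * s ^ μ - ν ^ 2 * s ^ μ / s ^ 2) * w s + s ^ μ * f s)

/-- Factorization of the damped operator: if `E' = b E` and `b` is a subsolution of the associated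
Riccati equation, then `E t^μ (w' - b w)` grows at least as the weighted source. -/
theorem DampedODE.factor {m μ ν t₁ : ℝ} {w g f : ℝ → ℝ} (h : DampedODE m μ ν t₁ w g f)
    {a c : ℝ} (ha : 1 ≤ a) (hac : a ≤ c) (hc : c ≤ t₁) {b b' E : ℝ → ℝ}
    (hb : ∀ t ∈ Icc a c, HasDerivAt b (b' t) t) (hb' : ContinuousOn b' (Icc a c))
    (hE : ∀ t ∈ Icc a c, HasDerivAt E (b t * E t) t) (hE0 : ∀ t ∈ Icc a c, 0 ≤ E t)
    (hw : ∀ t ∈ Icc a c, 0 ≤ w t)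
    (hric : ∀ t ∈ Icc a c, b' t + b t ^ 2 + μ * b t / t + ν ^ 2 / t ^ 2 ≤ t ^ (2 * m)) :
    (∫ s in a..c, E s * (s ^ μ * f s)) ≤
      E c * (c ^ μ * (g c - b c * w c)) - E a * (a ^ μ * (g a - b a * w a)) := by
  have hI : uIcc a c = Icc a c := uIcc_of_le hac
  have hsub : Icc a c ⊆ Icc 1 t₁ := Icc_subset_Icc ha hc
  have hpos : ∀ t ∈ Icc a c, 0 < t := fun t ht => by linarith [ht.1]
  have hrp : ∀ q : ℝ, ContinuousOn (fun s : ℝ => s ^ q) (Icc 1 t₁) := fun q =>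
    continuousOn_id.rpow_const fun s hs => Or.inl (by have := hs.1; simp only [id]; linarith)
  have hcoef : ContinuousOn (fun s : ℝ => (s ^ (2 * m) * s ^ μ - ν ^ 2 * s ^ μ / s ^ 2) * w s)
      (Icc 1 t₁) := by
    refine ContinuousOn.mul (((hrp _).mul (hrp _)).sub ?_) h.cont_w
    refine (continuousOn_const.mul (hrp _)).div (continuousOn_id.pow 2) fun s hs => ?_
    have : 0 < s := by linarith [hs.1]
    simpa using this.ne'
  have hint : IntervalIntegrable (fun s => (s ^ (2 * m) * s ^ μ - ν ^ 2 * s ^ μ / s ^ 2) * w s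
      + s ^ μ * f s) volume 1 t₁ :=
    (ContinuousOn.intervalIntegrable (by rwa [uIcc_of_le h.one_le])).add h.source_integrable
  have hmono : ∀ {x y : ℝ}, 1 ≤ x → x ≤ y → y ≤ t₁ → uIcc x y ⊆ uIcc 1 t₁ := fun h1 h2 h3 => by
    rw [uIcc_of_le h2, uIcc_of_le h.one_le]; exact Icc_subset_Icc h1 h3
  have hr := hint.mono_set (hmono ha hac hc)
  have hcE : ContinuousOn E (Icc a c) := fun t ht => (hE t ht).continuousAt.continuousWithinAt
  have hcb : ContinuousOn b (Icc a c) := fun t ht => (hb t ht).continuousAt.continuousWithinAt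
  have hcw := h.cont_w.mono hsub
  have hcg := h.cont_g.mono hsub
  have hpw : ∀ q : ℝ, ContinuousOn (fun s : ℝ => s ^ q) (Icc a c) := fun q => (hrp q).mono hsub
  have hy : ∀ t ∈ Icc a c, (fun t => t ^ μ * g t) t = a ^ μ * g a +
      ∫ s in a..t, ((s ^ (2 * m) * s ^ μ - ν ^ 2 * s ^ μ / s ^ 2) * w s + s ^ μ * f s) := by
    intro t ht
    simp only
    rw [h.eq t (hsub ht), h.eq a (hsub ⟨le_rfl, hac⟩), add_assoc,
      intervalIntegral.integral_add_adjacent_intervals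
        (hint.mono_set (hmono le_rfl ha (hac.trans hc)))
        (hint.mono_set (hmono ha ht.1 (ht.2.trans hc)))]
  have h1 := integral_by_parts_primitive hac hr hy hE (hcb.mul hcE)
  -- `D` is the derivative of `E t^μ b w`. This part is classical because `w` is differentiable;
  -- only `E t^μ g` needs the absolutely continuous integration by parts.
  set D : ℝ → ℝ := fun s => b s * E s * (s ^ μ * b s * w s) + E s * (((μ * s ^ (μ - 1)) * b s
    + s ^ μ * b' s) * w s + s ^ μ * b s * g s) with hD
  have hcD : ContinuousOn D (Icc a c) :=
    ((hcb.mul hcE).mul (((hpw _).mul hcb).mul hcw)).add (hcE.mul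
      (((((continuousOn_const.mul (hpw _)).mul hcb).add ((hpw _).mul hb')).mul hcw).add
        (((hpw _).mul hcb).mul hcg)))
  have hID : IntervalIntegrable D volume a c := ContinuousOn.intervalIntegrable (hI ▸ hcD)
  have h2 : ∫ s in a..c, D s = E c * (c ^ μ * b c * w c) - E a * (a ^ μ * b a * w a) := by
    refine intervalIntegral.integral_eq_sub_of_hasDerivAt_of_le hac
      (f := fun s => E s * (s ^ μ * b s * w s)) (hcE.mul (((hpw _).mul hcb).mul hcw)) ?_ hID
    intro t ht
    have ht' := Ioo_subset_Icc_self ht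
    have hwd := h.deriv_w t ⟨by linarith [ht.1], by linarith [ht.2]⟩
    have hμd : HasDerivAt (fun s : ℝ => s ^ μ) (μ * t ^ (μ - 1)) t :=
      Real.hasDerivAt_rpow_const (Or.inl (hpos t ht').ne')
    exact (hE t ht').fun_mul ((hμd.fun_mul (hb t ht')).fun_mul hwd)
  have hI1 : IntervalIntegrable (fun s => (b s * E s) * (s ^ μ * g s) + E s *
      ((s ^ (2 * m) * s ^ μ - ν ^ 2 * s ^ μ / s ^ 2) * w s + s ^ μ * f s)) volume a c :=
    (ContinuousOn.intervalIntegrable (hI ▸ ((hcb.mul hcE).mul ((hpw _).mul hcg)))).add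
      (hr.continuousOn_mul (hI ▸ hcE))
  have hI2 : IntervalIntegrable (fun s => E s * (s ^ μ * f s)) volume a c :=
    (h.source_integrable.mono_set (hmono ha hac hc)).continuousOn_mul (hI ▸ hcE)
  have h3 : E c * (c ^ μ * (g c - b c * w c)) - E a * (a ^ μ * (g a - b a * w a)) =
      ∫ s in a..c, ((b s * E s) * (s ^ μ * g s) + E s *
      ((s ^ (2 * m) * s ^ μ - ν ^ 2 * s ^ μ / s ^ 2) * w s + s ^ μ * f s) - D s) := by
    rw [intervalIntegral.integral_sub hI1 hID, h2, ← h1]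
    ring
  rw [h3]
  refine intervalIntegral.integral_mono_on hac hI2 (hI1.sub hID) fun s hs => ?_
  have hs0 := hpos s hs
  have hμs : s ^ (μ - 1) = s ^ μ / s := Real.rpow_sub_one hs0.ne' μ
  -- The terms in `g` cancel, and the coefficient of `w` is exactly the Riccati defect.
  have : (b s * E s) * (s ^ μ * g s) + E s *
      ((s ^ (2 * m) * s ^ μ - ν ^ 2 * s ^ μ / s ^ 2) * w s + s ^ μ * f s) - D s =
      E s * (s ^ μ * f s) + E s * s ^ μ * w s *
        (s ^ (2 * m) - (b' s + b s ^ 2 + μ * b s / s + ν ^ 2 / s ^ 2)) := by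
    simp only [hD, hμs]
    field_simp
    ring
  rw [this]
  have h4 : 0 ≤ E s * s ^ μ * w s := mul_nonneg (mul_nonneg (hE0 s hs)
    (Real.rpow_nonneg hs0.le _)) (hw s hs)
  nlinarith [mul_nonneg h4 (sub_nonneg.2 (hric s hs))]

/-! ### Continuity argument and Riccati-type blow-up -/

/-- A continuous function that is positive at `a`, and at least its initial value as long as it has
been positive, stays at least its initial value. -/
theorem bootstrap_ge {a c : ℝ} {X : ℝ → ℝ} (hX : ContinuousOn X (Icc a c)) (h0 : 0 < X a)
    (hstep : ∀ τ ∈ Icc a c, (∀ s ∈ Ico a τ, 0 < X s) → X a ≤ X τ) :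
    ∀ τ ∈ Icc a c, X a ≤ X τ := by
  have hpos : ∀ s ∈ Icc a c, 0 < X s := by
    by_contra! hcon
    obtain ⟨s, hs, hs0⟩ := hcon
    -- By compactness there is a first time at which `X ≤ 0`; `hstep` applies there and contradicts
    -- it.
    have hK : IsCompact (Icc a c ∩ X ⁻¹' Iic 0) :=
      isCompact_Icc.of_isClosed_subset (hX.preimage_isClosed_of_isClosed isClosed_Icc isClosed_Iic)
        inter_subset_left
    obtain ⟨τ, ⟨hτ, hτ0⟩, hmin⟩ := hK.exists_isLeast ⟨s, hs, hs0⟩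
    have := hstep τ hτ fun r hr => by
      by_contra hr0
      exact absurd (hmin ⟨⟨hr.1, hr.2.le.trans hτ.2⟩, not_lt.1 hr0⟩) (not_le.2 hr.2)
    have hτ1 : X τ ≤ 0 := hτ0
    linarith
  exact fun τ hτ => hstep τ hτ fun s hs => hpos s ⟨hs.1, hs.2.le.trans hτ.2⟩

/-- Blow-up for a nonlinear integral inequality of Riccati type. -/
theorem integral_rpow_neg_le_of_integral_inequality {a c p γ k x₀ : ℝ} (ha : 0 < a) (hac : a ≤ c)
    (hp : 1 < p) (hk : 0 < k) (hx₀ : 0 < x₀) {h : ℝ → ℝ} (hcont : ContinuousOn h (Icc a c))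
    (hineq : ∀ t ∈ Icc a c, x₀ + k * ∫ s in a..t, h s ^ p * s ^ (-γ) ≤ h t)
    (h0 : ∀ t ∈ Icc a c, 0 ≤ h t) :
    ∫ s in a..c, s ^ (-γ) ≤ x₀ ^ (-(p - 1)) / (k * (p - 1)) := by
  have hI : uIcc a c = Icc a c := uIcc_of_le hac
  have hpos : ∀ s ∈ Icc a c, 0 < s := fun s hs => by linarith [hs.1]
  have hγ : ContinuousOn (fun s : ℝ => s ^ (-γ)) (Icc a c) :=
    continuousOn_id.rpow_const fun s hs => Or.inl (hpos s hs).ne'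
  have hq : ContinuousOn (fun s => h s ^ p * s ^ (-γ)) (Icc a c) :=
    (hcont.rpow_const fun s _ => Or.inr (by linarith)).mul hγ
  have hprim : ∀ {q : ℝ → ℝ}, ContinuousOn q (Icc a c) →
      ContinuousOn (fun t => ∫ s in a..t, q s) (Icc a c) ∧
      ∀ t ∈ Ioo a c, HasDerivAt (fun t => ∫ s in a..t, q s) (q t) t := by
    intro q hq
    refine ⟨?_, fun t ht => ?_⟩
    · have := intervalIntegral.continuousOn_primitive_interval (μ := volume) (f := q) (a := a)
        (b := c) (by rw [hI]; exact hq.integrableOn_compact isCompact_Icc)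
      rwa [hI] at this
    · refine intervalIntegral.integral_hasDerivAt_right ?_ ?_ ?_
      · refine ContinuousOn.intervalIntegrable ?_
        rw [uIcc_of_le ht.1.le]; exact hq.mono (Icc_subset_Icc le_rfl ht.2.le)
      · exact (hq.mono Ioo_subset_Icc_self).stronglyMeasurableAtFilter isOpen_Ioo t ht
      · exact hq.continuousAt (Icc_mem_nhds ht.1 ht.2)
  obtain ⟨hHc, hHd⟩ := hprim hq
  obtain ⟨hGc, hGd⟩ := hprim hγ
  set H : ℝ → ℝ := fun t => x₀ + k * ∫ s in a..t, h s ^ p * s ^ (-γ) with hH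
  have hHpos : ∀ t ∈ Icc a c, 0 < H t := fun t ht => by
    have : 0 ≤ ∫ s in a..t, h s ^ p * s ^ (-γ) :=
      intervalIntegral.integral_nonneg ht.1 fun s hs => by
        have hs' : s ∈ Icc a c := ⟨hs.1, hs.2.trans ht.2⟩
        exact mul_nonneg (Real.rpow_nonneg (h0 s hs') _) (Real.rpow_nonneg (hpos s hs').le _)
    have := mul_nonneg hk.le this
    simp only [hH]; linarith
  -- The right-hand side `H` of the inequality is differentiable even though `h` need not be. Since
  -- `H' ≥ k H^p t^(-γ)`, the power `H^(-(p-1))` falls at rate at least `k (p-1) t^(-γ)`, yet stays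
  -- positive.
  have hJ : MonotoneOn (fun t => -(H t ^ (-(p - 1))) - k * (p - 1) * ∫ s in a..t, s ^ (-γ))
      (Icc a c) := by
    refine monotoneOn_of_deriv_nonneg (convex_Icc a c) ?_ ?_ ?_
    · refine ContinuousOn.sub (ContinuousOn.neg (ContinuousOn.rpow_const
        (continuousOn_const.add (continuousOn_const.mul hHc)) fun t ht => Or.inl (hHpos t ht).ne'))
        (continuousOn_const.mul hGc)
    all_goals
      rw [interior_Icc]
      have hd : ∀ t ∈ Ioo a c, HasDerivAt
          (fun t => -(H t ^ (-(p - 1))) - k * (p - 1) * ∫ s in a..t, s ^ (-γ))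
          (-(k * (h t ^ p * t ^ (-γ)) * (-(p - 1)) * H t ^ (-(p - 1) - 1))
            - k * (p - 1) * t ^ (-γ)) t := fun t ht =>
        ((((hHd t ht).const_mul k).const_add x₀).rpow_const
          (Or.inl (hHpos t (Ioo_subset_Icc_self ht)).ne')).neg.sub ((hGd t ht).const_mul _)
    · exact fun t ht => (hd t ht).differentiableAt.differentiableWithinAt
    · intro t ht
      have ht' := Ioo_subset_Icc_self ht
      rw [(hd t ht).deriv]
      have hHt := hHpos t ht'
      have e1 : H t ^ (-(p - 1) - 1) * H t ^ p = 1 := by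
        rw [← Real.rpow_add hHt]; ring_nf; simp
      have e2 : H t ^ p ≤ h t ^ p := Real.rpow_le_rpow hHt.le (hineq t ht') (by linarith)
      have e3 : 1 ≤ H t ^ (-(p - 1) - 1) * h t ^ p := by
        have := mul_le_mul_of_nonneg_left e2 (Real.rpow_nonneg hHt.le (-(p - 1) - 1))
        rwa [e1] at this
      have e4 : 0 ≤ k * (p - 1) * t ^ (-γ) :=
        mul_nonneg (mul_nonneg hk.le (by linarith)) (Real.rpow_nonneg (hpos t ht').le _)
      nlinarith [mul_nonneg e4 (sub_nonneg.2 e3)]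
  have := hJ ⟨le_rfl, hac⟩ ⟨hac, le_rfl⟩ hac
  simp only [intervalIntegral.integral_same, mul_zero, sub_zero] at this
  have hHa : H a = x₀ := by simp [hH]
  rw [hHa] at this
  have hc' : 0 ≤ H c ^ (-(p - 1)) := Real.rpow_nonneg (hHpos c ⟨hac, le_rfl⟩).le _
  rw [le_div_iff₀ (mul_pos hk (by linarith))]
  linarith

/-! ### Growing branch: positivity of the average -/

theorem hasDerivAt_phi {m t : ℝ} (hm : 0 ≤ m) (ht : 0 < t) : HasDerivAt (phi m) (t ^ m) t := by
  have := (Real.hasDerivAt_rpow_const (p := 1 + m) (Or.inl ht.ne')).div_const (1 + m)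
  rw [mul_div_cancel_left₀ _ (by positivity : (1 + m) ≠ 0), add_sub_cancel_left] at this
  exact this

/-- The exponent `(1 - μ + √δ)/2` of the slowly growing solution of the Euler equation
`w'' + (μ/t) w' + (ν²/t²) w = 0`. -/
noncomputable def eulerExponent (μ ν : ℝ) : ℝ := (1 - μ + √(discr μ ν)) / 2

theorem eulerExponent_root {μ ν : ℝ} (hδ : 0 ≤ discr μ ν) :
    eulerExponent μ ν ^ 2 + (μ - 1) * eulerExponent μ ν + ν ^ 2 = 0 := by
  have h := Real.sq_sqrt hδ
  unfold eulerExponent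
  have h2 : discr μ ν = (μ - 1) ^ 2 - 4 * ν ^ 2 := rfl
  rw [h2] at h ⊢
  nlinarith

theorem rpow_two_mul_eq {m t : ℝ} (ht : 0 < t) : t ^ (2 * m) = (t ^ m) ^ 2 := by
  rw [← Real.rpow_natCast, ← Real.rpow_mul ht.le]; congr 1; push_cast; ring

/-- Positivity of the solution of the damped equation, and a quantitative lower bound of
`w' - (κ/t + θ t^m) w`. -/
theorem exists_positivity {m μ ν A₀ A₁ : ℝ} (hm : 0 ≤ m) (hδ : 0 ≤ discr μ ν)
    (hA₀ : 0 ≤ A₀) (hA : eulerExponent μ ν * A₀ < A₁) :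
    ∃ θ : ℝ, 0 < θ ∧ ∃ c : ℝ, 0 < c ∧ ∀ ε : ℝ, 0 < ε → ∀ (t₁ : ℝ) (w g f : ℝ → ℝ),
      DampedODE m μ ν t₁ w g f → w 1 = ε * A₀ → g 1 = ε * A₁ → ∀ t ∈ Icc 1 t₁, 0 ≤ w t ∧
        c * ε ≤ t ^ eulerExponent μ ν * Real.exp (θ * phi m t) *
          (t ^ μ * (g t - (eulerExponent μ ν / t + θ * t ^ m) * w t)) := by
  set κ := eulerExponent μ ν with hκ
  set S := √(discr μ ν) with hS
  have hS0 : 0 ≤ S := Real.sqrt_nonneg _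
  -- The first bound on `θ` makes `b` a Riccati subsolution, the second keeps the initial value of
  -- `X` positive. The denominator `A₀ + 1` allows `A₀ = 0`.
  obtain ⟨θ, hθ, hθ1, hθA⟩ : ∃ θ : ℝ, 0 < θ ∧ θ * (m + 2 + S) ≤ 1 ∧ θ * A₀ < A₁ - κ * A₀ := by
    have h1 : 0 < m + 2 + S := by positivity
    have h2 : 0 < A₁ - κ * A₀ := by linarith
    refine ⟨min (1 / (m + 2 + S)) ((A₁ - κ * A₀) / (A₀ + 1)), by positivity, ?_, ?_⟩
    · rw [← le_div_iff₀ h1]; exact min_le_left _ _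
    · calc _ ≤ (A₁ - κ * A₀) / (A₀ + 1) * A₀ := by gcongr; exact min_le_right _ _
        _ < A₁ - κ * A₀ := by
          rw [div_mul_eq_mul_div, div_lt_iff₀ (by positivity)]; nlinarith
  have hκS : 2 * κ + μ = 1 + S := by simp only [hκ, eulerExponent, hS]; ring
  have hroot := eulerExponent_root hδ
  rw [← hκ] at hroot
  refine ⟨θ, hθ, Real.exp (θ * phi m 1) * (A₁ - (κ + θ) * A₀),
    mul_pos (Real.exp_pos _) (by linarith), ?_⟩
  intro ε hε t₁ w g f h hw1 hg1
  set b : ℝ → ℝ := fun t => κ / t + θ * t ^ m with hb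
  set b' : ℝ → ℝ := fun t => -κ / t ^ 2 + θ * (m * t ^ (m - 1)) with hb'
  set E : ℝ → ℝ := fun t => t ^ κ * Real.exp (θ * phi m t) with hE
  have hEpos : ∀ t, 0 < t → 0 < E t := fun t ht =>
    mul_pos (Real.rpow_pos_of_pos ht _) (Real.exp_pos _)
  have hEd : ∀ t, 0 < t → HasDerivAt E (b t * E t) t := by
    intro t ht
    refine ((Real.hasDerivAt_rpow_const (p := κ) (Or.inl ht.ne')).fun_mul
      ((hasDerivAt_phi hm ht).const_mul θ).exp).congr_deriv ?_
    rw [Real.rpow_sub_one ht.ne']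
    simp only [hb, hE]; field_simp
  have hbd : ∀ t, 0 < t → HasDerivAt b (b' t) t := by
    intro t ht
    refine (((hasDerivAt_const t κ).fun_div (hasDerivAt_id t) ht.ne').add
      ((Real.hasDerivAt_rpow_const (p := m) (Or.inl ht.ne')).const_mul θ)).congr_deriv ?_
    simp [hb']
  have hrp : ∀ q : ℝ, ContinuousOn (fun s : ℝ => s ^ q) (Ioi 0) := fun q =>
    continuousOn_id.rpow_const fun s hs => Or.inl (ne_of_gt hs)
  have hb'c : ContinuousOn b' (Ioi 0) :=
    (continuousOn_const.div (continuousOn_id.pow 2) fun s hs => pow_ne_zero 2 (ne_of_gt hs)).add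
      (continuousOn_const.mul (continuousOn_const.mul (hrp _)))
  have hric : ∀ t, 1 ≤ t → b' t + b t ^ 2 + μ * b t / t + ν ^ 2 / t ^ 2 ≤ t ^ (2 * m) := by
    intro t ht
    have ht0 : 0 < t := by linarith
    have hx : 1 ≤ t ^ m := Real.one_le_rpow ht hm
    simp only [hb, hb']
    rw [rpow_two_mul_eq ht0, Real.rpow_sub_one ht0.ne']
    set x := t ^ m
    have e1 : -κ / t ^ 2 + θ * (m * (x / t)) + (κ / t + θ * x) ^ 2 + μ * (κ / t + θ * x) / t
        + ν ^ 2 / t ^ 2 = (κ ^ 2 + (μ - 1) * κ + ν ^ 2) / t ^ 2 + θ * (m + (2 * κ + μ)) * (x / t)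
        + θ ^ 2 * x ^ 2 := by field_simp; ring
    -- The `1/t²` terms vanish because `κ` is a root of the Euler characteristic equation; the rest
    -- is of order `θ t^(2m)` for `t ≥ 1`.
    rw [e1, hroot, hκS, zero_div, zero_add]
    have e2 : x / t ≤ x ^ 2 := by
      rw [div_le_iff₀ ht0]; nlinarith [mul_le_mul hx ht (by norm_num) (by linarith)]
    have e3 : θ ≤ 1 := by nlinarith
    have e4 : θ * (m + (1 + S)) * (x / t) ≤ θ * (m + (1 + S)) * x ^ 2 := by gcongr
    have e5 : θ ^ 2 * x ^ 2 ≤ θ * x ^ 2 := by gcongr; nlinarith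
    nlinarith [sq_nonneg x]
  have h1t : ∀ {τ s : ℝ}, s ∈ Icc 1 τ → 0 < s := fun hs => by linarith [hs.1]
  set X : ℝ → ℝ := fun t => E t * (t ^ μ * (g t - b t * w t)) with hX
  have hsubI : Icc 1 t₁ ⊆ Ioi (0 : ℝ) := fun s hs => h1t hs
  have hXc : ContinuousOn X (Icc 1 t₁) :=
    ContinuousOn.mul (fun t ht => (hEd t (h1t ht)).continuousAt.continuousWithinAt)
      (((hrp μ).mono hsubI).mul (h.cont_g.sub
        (ContinuousOn.mul (fun t ht => (hbd t (h1t ht)).continuousAt.continuousWithinAt) h.cont_w)))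
  have hwnn : ∀ τ ∈ Icc 1 t₁, (∀ s ∈ Ico 1 τ, 0 < X s) → ∀ t ∈ Icc 1 τ, 0 ≤ w t := by
    intro τ hτ hpos
    -- `(w/E)' = (g - b w)/E`, so positivity of `X` makes `w/E` increase from a nonnegative value.
    -- This closes the loop, since monotonicity of `X` itself needs `w ≥ 0`.
    have hmono : MonotoneOn (fun t => w t / E t) (Icc 1 τ) := by
      have hd : ∀ t ∈ Ioo 1 τ, HasDerivAt (fun t => w t / E t)
          ((g t * E t - w t * (b t * E t)) / E t ^ 2) t := fun t ht =>
        (h.deriv_w t ⟨ht.1, ht.2.trans_le hτ.2⟩).fun_div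
          (hEd t (by linarith [ht.1])) (hEpos t (by linarith [ht.1])).ne'
      refine monotoneOn_of_deriv_nonneg (convex_Icc _ _) ?_ ?_ ?_
      · exact (h.cont_w.mono (Icc_subset_Icc le_rfl hτ.2)).div
          (fun t ht => (hEd t (h1t ht)).continuousAt.continuousWithinAt)
          fun t ht => (hEpos t (h1t ht)).ne'
      · rw [interior_Icc]
        exact fun t ht => (hd t ht).differentiableAt.differentiableWithinAt
      · rw [interior_Icc]
        intro t ht
        rw [(hd t ht).deriv]
        have h0 : 0 < t := by linarith [ht.1]
        have hE0 := hEpos t h0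
        have h1 := hpos t ⟨ht.1.le, ht.2⟩
        have h2 : 0 < g t - b t * w t :=
          pos_of_mul_pos_right (pos_of_mul_pos_right h1 hE0.le) (Real.rpow_pos_of_pos h0 _).le
        rw [show g t * E t - w t * (b t * E t) = (g t - b t * w t) * E t by ring]
        positivity
    intro t ht
    have h1 := hmono ⟨le_rfl, ht.1.trans ht.2⟩ ht ht.1
    have h2 : 0 ≤ w 1 / E 1 := by
      rw [hw1]; exact div_nonneg (by positivity) (hEpos 1 one_pos).le
    have h3 := h2.trans h1
    by_contra hcon
    exact absurd (div_neg_of_neg_of_pos (not_le.1 hcon) (hEpos t (h1t ht))) (not_lt.2 h3)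
  have hX1 : X 1 = Real.exp (θ * phi m 1) * (A₁ - (κ + θ) * A₀) * ε := by
    simp only [hX, hE, hb, Real.one_rpow, hw1, hg1]; ring
  have hX1pos : 0 < X 1 := by
    rw [hX1]; exact mul_pos (mul_pos (Real.exp_pos _) (by linarith)) hε
  have hstep : ∀ τ ∈ Icc 1 t₁, (∀ s ∈ Ico 1 τ, 0 < X s) → X 1 ≤ X τ := by
    intro τ hτ hpos
    have := h.factor le_rfl hτ.1 hτ.2 (b := b) (b' := b') (E := E)
      (fun t ht => hbd t (h1t ht)) (hb'c.mono fun s hs => h1t hs) (fun t ht => hEd t (h1t ht))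
      (fun t ht => (hEpos t (h1t ht)).le) (hwnn τ hτ hpos) (fun t ht => hric t ht.1)
    have h0 : 0 ≤ ∫ s in (1 : ℝ)..τ, E s * (s ^ μ * f s) :=
      intervalIntegral.integral_nonneg hτ.1 fun s hs => mul_nonneg (hEpos s (h1t hs)).le
        (mul_nonneg (Real.rpow_nonneg (h1t hs).le _) (h.source_nonneg s))
    simp only [hX]; linarith
  have hge := bootstrap_ge hXc hX1pos hstep
  intro t ht
  refine ⟨hwnn t ht (fun s hs => ?_) t ⟨ht.1, le_rfl⟩, ?_⟩
  · exact hX1pos.trans_le (hge s ⟨hs.1, hs.2.le.trans ht.2⟩)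
  · rw [← hX1]; exact hge t ht

/-! ### Decaying branch and the nonlinear feedback -/

/-- Pointwise form of the nonlinear feedback after renormalization by the growth of the
solutions of the linear equation. -/
theorem renormalized_source_ge {p L Q M h g f D s ρ : ℝ} (hp : 1 < p) (hL : 0 < L) (hQ : 0 < Q)
    (hM : 0 < M) (hh : 0 ≤ h) (hD : 0 < D) (hs : 0 < s) (hg : 0 ≤ g)
    (hhg : h ≤ L * (Q * g)) (hf : g ^ p ≤ f * M ^ (p - 1)) (hQM : Q * M ≤ D * s ^ ρ) :
    L ^ (-p) * D ^ (-(p - 1)) * (h ^ p * s ^ (-(ρ * (p - 1)))) ≤ Q * f := by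
  have hQMp : (Q * M) ^ (p - 1) ≤ D ^ (p - 1) * s ^ (ρ * (p - 1)) := by
    rw [Real.rpow_mul hs.le, ← Real.mul_rpow hD.le (Real.rpow_nonneg hs.le _)]
    exact Real.rpow_le_rpow (by positivity) hQM (by linarith)
  have h1 : h ^ p ≤ L ^ p * (Q ^ p * g ^ p) := by
    rw [← Real.mul_rpow hQ.le hg, ← Real.mul_rpow hL.le (by positivity)]
    exact Real.rpow_le_rpow hh hhg (by linarith)
  have hQp : Q ^ p = Q * Q ^ (p - 1) := by
    rw [← Real.rpow_one_add' hQ.le (by linarith)]; ring_nf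
  have hf0 : 0 ≤ f := by
    have : 0 ≤ f * M ^ (p - 1) := (Real.rpow_nonneg hg _).trans hf
    exact nonneg_of_mul_nonneg_left this (Real.rpow_pos_of_pos hM _)
  have h2 : h ^ p ≤ L ^ p * (D ^ (p - 1) * s ^ (ρ * (p - 1))) * (Q * f) :=
    calc h ^ p ≤ L ^ p * (Q ^ p * g ^ p) := h1
      _ ≤ L ^ p * (Q ^ p * (f * M ^ (p - 1))) := by gcongr
      _ = L ^ p * (Q * M) ^ (p - 1) * (Q * f) := by
        rw [hQp, Real.mul_rpow hQ.le hM.le]; ring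
      _ ≤ _ := by gcongr
  have hc : 0 < L ^ p * (D ^ (p - 1) * s ^ (ρ * (p - 1))) := by positivity
  rw [Real.rpow_neg hL.le, Real.rpow_neg hD.le, Real.rpow_neg hs.le]
  calc _ = h ^ p / (L ^ p * (D ^ (p - 1) * s ^ (ρ * (p - 1)))) := by field_simp
    _ ≤ Q * f := by rw [div_le_iff₀ hc]; linarith

set_option maxHeartbeats 1000000 in
/-- Lifespan bound for the damped equation with a source dominating a power of the velocity. -/
theorem exists_integral_rpow_neg_le {m μ ν A₀ A₁ p D σ : ℝ} (hm : 0 ≤ m) (hμ : 0 ≤ μ)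
    (hδ : 0 ≤ discr μ ν) (hp : 1 < p) (hA₀ : 0 ≤ A₀) (hA : eulerExponent μ ν * A₀ < A₁)
    (hD : 0 < D) :
    ∃ T₀ : ℝ, 1 ≤ T₀ ∧ ∃ K : ℝ, 0 < K ∧ ∀ ε : ℝ, 0 < ε → ∀ (t₁ : ℝ) (w g f : ℝ → ℝ), T₀ ≤ t₁ →
      DampedODE m μ ν t₁ w g f → w 1 = ε * A₀ → g 1 = ε * A₁ →
      (∀ᵐ s, s ∈ Icc 1 t₁ → 0 ≤ g s →
        g s ^ p ≤ f s * (D * s ^ σ * Real.exp (phi m s)) ^ (p - 1)) →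
      ∫ s in T₀..t₁, s ^ (-((σ + (μ - m) / 2) * (p - 1))) ≤ K * ε ^ (-(p - 1)) := by
  obtain ⟨θ, hθ, c, hc, hpos⟩ := exists_positivity (μ := μ) (ν := ν) hm hδ hA₀ hA
  set κ := eulerExponent μ ν with hκ
  clear_value κ
  -- `q` dominates the coefficient of the `1/t²` error left by the WKB ansatz; the cross term `-2
  -- (q/t²) t^m` then absorbs this error together with `(q/t²)²`.
  obtain ⟨q, hq1, hqK⟩ : ∃ q : ℝ, 1 ≤ q ∧
      (m + μ) / 2 + (m + μ) ^ 2 / 4 - μ * (m + μ) / 2 + ν ^ 2 ≤ q :=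
    ⟨_, le_max_left _ _, le_max_right _ _⟩
  -- Beyond `T₀` one has `q/t² ≤ 1` and `|κ|/t ≤ θ/2`, so a possibly negative `κ` costs at most half
  -- of `θ t^m`.
  obtain ⟨T₀, hT₀q, hT₀κ⟩ : ∃ T₀ : ℝ, q ≤ T₀ ∧ 2 * |κ| / θ ≤ T₀ :=
    ⟨_, le_max_left _ _, le_max_right _ _⟩
  have hT₀1 : 1 ≤ T₀ := hq1.trans hT₀q
  -- From `-b ≤ (1 + (m+μ)/2) t^m` and `t^m w ≤ (2/θ) g` follows `g - b w ≤ L g`.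
  obtain ⟨L, hL⟩ : ∃ L : ℝ, L = 1 + (1 + (m + μ) / 2) * (2 / θ) := ⟨_, rfl⟩
  have hL0 : 0 < L := by rw [hL]; positivity
  set b : ℝ → ℝ := fun t => -t ^ m - (m + μ) / 2 / t + q / t ^ 2 with hb
  set b' : ℝ → ℝ := fun t => -(m * t ^ (m - 1)) + (m + μ) / 2 / t ^ 2 - 2 * q / t ^ 3 with hb'
  set E : ℝ → ℝ := fun t => Real.exp (-phi m t - q / t) * t ^ (-((m + μ) / 2)) with hE
  have hEpos : ∀ t, 0 < t → 0 < E t := fun t ht =>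
    mul_pos (Real.exp_pos _) (Real.rpow_pos_of_pos ht _)
  have hEd : ∀ t, 0 < t → HasDerivAt E (b t * E t) t := by
    intro t ht
    refine (((hasDerivAt_phi hm ht).fun_neg.fun_sub
      ((hasDerivAt_const t q).fun_div (hasDerivAt_id t) ht.ne')).exp.fun_mul
      (Real.hasDerivAt_rpow_const (p := -((m + μ) / 2)) (Or.inl ht.ne'))).congr_deriv ?_
    rw [Real.rpow_sub_one ht.ne']
    simp only [hb, hE, id]; field_simp; ring
  have hbd : ∀ t, 0 < t → HasDerivAt b (b' t) t := by
    intro t ht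
    refine (((Real.hasDerivAt_rpow_const (p := m) (Or.inl ht.ne')).fun_neg.fun_sub
      ((hasDerivAt_const t ((m + μ) / 2)).fun_div (hasDerivAt_id t) ht.ne')).fun_add
      ((hasDerivAt_const t q).fun_div ((hasDerivAt_id t).fun_pow 2)
        (pow_ne_zero 2 ht.ne'))).congr_deriv ?_
    simp only [hb', id]; field_simp; ring
  have hrp : ∀ r : ℝ, ContinuousOn (fun s : ℝ => s ^ r) (Ioi 0) := fun r =>
    continuousOn_id.rpow_const fun s hs => Or.inl (ne_of_gt hs)
  have hb'c : ContinuousOn b' (Ioi 0) :=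
    ((continuousOn_const.mul (hrp _)).neg.add (continuousOn_const.div (continuousOn_id.pow 2)
      fun s hs => pow_ne_zero 2 (ne_of_gt hs))).sub (continuousOn_const.div (continuousOn_id.pow 3)
      fun s hs => pow_ne_zero 3 (ne_of_gt hs))
  have hqt : ∀ t, T₀ ≤ t → q / t ^ 2 ≤ 1 := by
    intro t ht
    rw [div_le_one (by nlinarith)]; nlinarith
  have hric : ∀ t, T₀ ≤ t → b' t + b t ^ 2 + μ * b t / t + ν ^ 2 / t ^ 2 ≤ t ^ (2 * m) := by
    intro t ht
    have ht1 : 1 ≤ t := hT₀1.trans ht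
    have ht0 : 0 < t := by linarith
    have hx : 1 ≤ t ^ m := Real.one_le_rpow ht1 hm
    simp only [hb, hb']
    rw [rpow_two_mul_eq ht0, Real.rpow_sub_one ht0.ne']
    set x := t ^ m
    have e1 : -(m * (x / t)) + (m + μ) / 2 / t ^ 2 - 2 * q / t ^ 3
        + (-x - (m + μ) / 2 / t + q / t ^ 2) ^ 2 + μ * (-x - (m + μ) / 2 / t + q / t ^ 2) / t
        + ν ^ 2 / t ^ 2 = x ^ 2 +
          ((m + μ) / 2 + (m + μ) ^ 2 / 4 - μ * (m + μ) / 2 + ν ^ 2) / t ^ 2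
          + (q / t ^ 2) ^ 2 - 2 * (q / t ^ 2) * x - (2 + m) * (q / t ^ 2) / t := by
      field_simp; ring
    rw [e1]
    have e2 : ((m + μ) / 2 + (m + μ) ^ 2 / 4 - μ * (m + μ) / 2 + ν ^ 2) / t ^ 2 ≤ q / t ^ 2 := by
      gcongr
    have e3 : 0 ≤ q / t ^ 2 := by positivity
    have e4 : 0 ≤ (2 + m) * (q / t ^ 2) / t := by positivity
    have e5 := hqt t ht
    nlinarith
  -- The lower bound of `exists_positivity` at time `T₀`, rewritten in the normalization of `H`; it
  -- is linear in `ε`.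
  obtain ⟨c₃, hc₃⟩ : ∃ c₃, c₃ = E T₀ * T₀ ^ μ *
      (c / (T₀ ^ κ * Real.exp (θ * phi m T₀) * T₀ ^ μ)) := ⟨_, rfl⟩
  have hT₀0 : 0 < T₀ := by linarith
  have hc₃0 : 0 < c₃ := by
    have := hEpos T₀ hT₀0
    rw [hc₃]; positivity
  obtain ⟨k, hk⟩ : ∃ k, k = L ^ (-p) * D ^ (-(p - 1)) := ⟨_, rfl⟩
  have hk0 : 0 < k := by rw [hk]; positivity
  refine ⟨T₀, hT₀1, c₃ ^ (-(p - 1)) / (k * (p - 1)),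
    div_pos (Real.rpow_pos_of_pos hc₃0 _) (mul_pos hk0 (by linarith)), ?_⟩
  intro ε hε t₁ w g f ht₁ h hw1 hg1 hnl
  have hpos' := hpos ε hε t₁ w g f h hw1 hg1
  have hIcc : ∀ {t}, t ∈ Icc T₀ t₁ → t ∈ Icc 1 t₁ := fun ht => ⟨hT₀1.trans ht.1, ht.2⟩
  have h0t : ∀ {t}, t ∈ Icc T₀ t₁ → 0 < t := fun ht => hT₀0.trans_le ht.1
  have hsub : Icc T₀ t₁ ⊆ Icc 1 t₁ := fun t ht => hIcc ht
  have hsub0 : Icc T₀ t₁ ⊆ Ioi (0 : ℝ) := fun t ht => h0t ht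
  have hgz : ∀ t ∈ Icc T₀ t₁, c * ε / (t ^ κ * Real.exp (θ * phi m t) * t ^ μ) ≤
      g t - θ / 2 * t ^ m * w t := by
    intro t ht
    obtain ⟨hw0, hz⟩ := hpos' t (hIcc ht)
    have ht0 := h0t ht
    have hx : 1 ≤ t ^ m := Real.one_le_rpow (hIcc ht).1 hm
    rw [div_le_iff₀ (by positivity)]
    refine hz.trans ?_
    rw [← mul_assoc, mul_comm]
    gcongr
    have : -(θ / 2) ≤ κ / t := by
      rw [le_div_iff₀ ht0]
      have h1 := hT₀κ.trans ht.1
      rw [div_le_iff₀ hθ] at h1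
      nlinarith [neg_abs_le κ]
    nlinarith
  have hgpos : ∀ t ∈ Icc T₀ t₁, 0 < g t ∧ θ / 2 * t ^ m * w t ≤ g t := by
    intro t ht
    have ht0 := h0t ht
    have h1 := hgz t ht
    have h2 : 0 < c * ε / (t ^ κ * Real.exp (θ * phi m t) * t ^ μ) := by positivity
    have h3 : 0 ≤ θ / 2 * t ^ m * w t :=
      mul_nonneg (by positivity) (hpos' t (hIcc ht)).1
    constructor <;> linarith
  have hbb : ∀ t ∈ Icc T₀ t₁, b t ≤ 0 ∧ -b t ≤ (1 + (m + μ) / 2) * t ^ m := by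
    intro t ht
    have ht0 := h0t ht
    have hx : 1 ≤ t ^ m := Real.one_le_rpow (hIcc ht).1 hm
    have h1 := hqt t ht.1
    have h2 : 0 ≤ (m + μ) / 2 / t := by positivity
    have h3 : (m + μ) / 2 / t ≤ (m + μ) / 2 := div_le_self (by positivity) (hIcc ht).1
    have h4 : 0 ≤ q / t ^ 2 := by positivity
    simp only [hb]
    constructor
    · linarith
    · nlinarith [mul_nonneg (by positivity : 0 ≤ (m + μ) / 2) (sub_nonneg.2 hx)]
  set H : ℝ → ℝ := fun t => E t * (t ^ μ * (g t - b t * w t)) with hH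
  have hHc : ContinuousOn H (Icc T₀ t₁) :=
    ContinuousOn.mul (fun t ht => (hEd t (h0t ht)).continuousAt.continuousWithinAt)
      (((hrp μ).mono hsub0).mul ((h.cont_g.mono hsub).sub
        (ContinuousOn.mul (fun t ht => (hbd t (h0t ht)).continuousAt.continuousWithinAt)
          (h.cont_w.mono hsub))))
  have hHge : ∀ t ∈ Icc T₀ t₁, E t * t ^ μ * g t ≤ H t ∧ H t ≤ L * (E t * t ^ μ * g t) := by
    intro t ht
    have hQ : 0 < E t * t ^ μ := mul_pos (hEpos t (h0t ht)) (Real.rpow_pos_of_pos (h0t ht) _)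
    have hw0 := (hpos' t (hIcc ht)).1
    obtain ⟨hb0, hb1⟩ := hbb t ht
    obtain ⟨hg0, hg1⟩ := hgpos t ht
    have e1 : g t ≤ g t - b t * w t := by nlinarith
    have e2 : g t - b t * w t ≤ L * g t := by
      have e3 : -b t * w t ≤ (1 + (m + μ) / 2) * t ^ m * w t := by gcongr
      have e4 : (1 + (m + μ) / 2) * t ^ m * w t =
          (1 + (m + μ) / 2) * (2 / θ) * (θ / 2 * t ^ m * w t) := by field_simp
      have e5 : (1 + (m + μ) / 2) * (2 / θ) * (θ / 2 * t ^ m * w t) ≤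
          (1 + (m + μ) / 2) * (2 / θ) * g t := by gcongr
      rw [hL]; linarith
    simp only [hH, ← mul_assoc]
    constructor
    · gcongr
    · rw [show L * E t * t ^ μ * g t = E t * t ^ μ * (L * g t) by ring]; gcongr
  have hH0 : ∀ t ∈ Icc T₀ t₁, 0 ≤ H t := fun t ht =>
    (mul_pos (mul_pos (hEpos t (h0t ht)) (Real.rpow_pos_of_pos (h0t ht) _))
      (hgpos t ht).1).le.trans (hHge t ht).1
  have hinit : c₃ * ε ≤ H T₀ := by
    have hT : T₀ ∈ Icc T₀ t₁ := ⟨le_rfl, ht₁⟩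
    refine le_trans ?_ (hHge T₀ hT).1
    have h1 := hgz T₀ hT
    have h3 : 0 ≤ θ / 2 * T₀ ^ m * w T₀ := mul_nonneg (by positivity) (hpos' T₀ (hIcc hT)).1
    have hET := hEpos T₀ hT₀0
    rw [hc₃, mul_assoc, div_mul_eq_mul_div]
    gcongr
    linarith
  have hineq : ∀ t ∈ Icc T₀ t₁, c₃ * ε +
      k * ∫ s in T₀..t, H s ^ p * s ^ (-((σ + (μ - m) / 2) * (p - 1))) ≤ H t := by
    intro t ht
    have hfac := h.factor hT₀1 ht.1 ht.2 (b := b) (b' := b') (E := E)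
      (fun s hs => hbd s (hT₀0.trans_le hs.1)) (hb'c.mono fun s hs => hT₀0.trans_le hs.1)
      (fun s hs => hEd s (hT₀0.trans_le hs.1)) (fun s hs => (hEpos s (hT₀0.trans_le hs.1)).le)
      (fun s hs => (hpos' s ⟨hT₀1.trans hs.1, hs.2.trans ht.2⟩).1) (fun s hs => hric s hs.1)
    have hsubt : Icc T₀ t ⊆ Icc T₀ t₁ := Icc_subset_Icc le_rfl ht.2
    have hmono : k * ∫ s in T₀..t, H s ^ p * s ^ (-((σ + (μ - m) / 2) * (p - 1))) ≤
        ∫ s in T₀..t, E s * (s ^ μ * f s) := by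
      rw [← intervalIntegral.integral_const_mul]
      refine intervalIntegral.integral_mono_ae_restrict ht.1 ?_ ?_ ?_
      · refine ContinuousOn.intervalIntegrable ?_
        rw [uIcc_of_le ht.1]
        exact continuousOn_const.mul (((hHc.mono hsubt).rpow_const
          fun s _ => Or.inr (by linarith)).mul ((hrp _).mono (hsubt.trans hsub0)))
      · refine (h.source_integrable.mono_set ?_).continuousOn_mul ?_
        · rw [uIcc_of_le ht.1, uIcc_of_le h.one_le]
          exact hsubt.trans hsub
        · rw [uIcc_of_le ht.1]
          exact fun s hs => (hEd s (h0t (hsubt hs))).continuousAt.continuousWithinAt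
      · rw [Filter.EventuallyLE, ae_restrict_iff' measurableSet_Icc]
        filter_upwards [hnl] with s hs hsI
        have hs' := hsubt hsI
        have hs0 := h0t hs'
        have hg0 := (hgpos s hs').1
        have hE0 := hEpos s hs0
        rw [← mul_assoc (E s), hk]
        refine renormalized_source_ge (g := g s) hp hL0 (by positivity) ?_ (hH0 s hs') hD hs0 hg0.le
          ?_ (hs (hIcc hs') hg0.le) ?_
        · positivity
        · exact (hHge s hs').2
        -- The decay `exp (-phi m s)` of `E` cancels the exponential growth of the plane-wave mass,
        -- and only a power of `s` remains.
        · have e1 : E s * s ^ μ * (D * s ^ σ * Real.exp (phi m s)) =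
              D * s ^ (σ + (μ - m) / 2) * Real.exp (-(q / s)) := by
            have e2 : s ^ (-((m + μ) / 2)) * s ^ μ * s ^ σ = s ^ (σ + (μ - m) / 2) := by
              rw [← Real.rpow_add hs0, ← Real.rpow_add hs0]; ring_nf
            have e3 : Real.exp (-phi m s - q / s) * Real.exp (phi m s) =
                Real.exp (-(q / s)) := by
              rw [← Real.exp_add]; ring_nf
            rw [← e2, ← e3]; simp only [hE]; ring
          rw [e1]
          refine mul_le_of_le_one_right (by positivity) (Real.exp_le_one_iff.2 ?_)
          have : 0 ≤ q / s := by positivity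
          linarith
    simp only [hH] at hinit hfac ⊢
    simp only [hH] at hmono
    linarith
  have := integral_rpow_neg_le_of_integral_inequality hT₀0 ht₁ hp hk0 (mul_pos hc₃0 hε) hHc hineq
    hH0
  rw [Real.mul_rpow hc₃0.le hε.le] at this
  rw [div_mul_eq_mul_div]
  exact this

/-! ### Mass of a plane wave on a ball -/

/-- Integral of a plane wave over a ball: the exponential growth comes with the power
`(N - 1)/2` of the radius. -/
theorem exists_setIntegral_exp_le {N : ℕ} (i₀ : Fin N) :
    ∃ D : ℝ, 0 < D ∧ ∀ r : ℝ, 0 < r →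
      ∫ x in Metric.closedBall (0 : Space N) r, Real.exp (x i₀) ≤
        D * r ^ (((N : ℝ) - 1) / 2) * Real.exp r := by
  refine ⟨2 * (4 * Real.pi) ^ (((N : ℝ) - 1) / 2), by positivity, fun r hr => ?_⟩
  -- On the ball `|x'|² ≤ r² - x₁² ≤ 2r(r - x₁)`, with `x₁` the distinguished coordinate and `x'`
  -- the others. Half of the decay `exp (-(r - x₁))` thus pays for the Gaussian `exp (-|x'|²/(4r))`;
  -- the other half is integrable in `x₁ ≤ r`. The majorant is a product, so its integral is
  -- explicit.
  set h : Fin N → ℝ → ℝ := fun i => if i = i₀ then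
    (Iic r).indicator (fun s => Real.exp (-(r / 2)) * Real.exp (1 / 2 * s))
    else fun s => Real.exp (-(1 / (4 * r)) * s ^ 2) with hh
  have hh0 : ∀ i s, 0 ≤ h i s := by
    intro i s
    simp only [hh]
    split_ifs
    · exact indicator_nonneg (fun _ _ => by positivity) _
    · positivity
  have hint : ∀ i, Integrable (h i) := by
    intro i
    simp only [hh]
    split_ifs
    · exact (integrable_indicator_iff measurableSet_Iic).2
        ((integrableOn_exp_mul_Iic (by norm_num : (0 : ℝ) < 1 / 2) r).const_mul _)
    · exact integrable_exp_neg_mul_sq (by positivity)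
  have hprod : Integrable (fun y : Fin N → ℝ => ∏ i, h i (y i)) := Integrable.fintype_prod hint
  have hprod' : Integrable (fun x : Space N => ∏ i, h i (x i)) :=
    ((PiLp.volume_preserving_ofLp (Fin N)).integrable_comp
      hprod.aestronglyMeasurable).2 hprod
  have hval : ∫ x : Space N, ∏ i, h i (x i) = 2 * (4 * Real.pi * r) ^ (((N : ℝ) - 1) / 2) := by
    have e1 : ∫ x : Space N, ∏ i, h i (x i) = ∫ y : Fin N → ℝ, ∏ i, h i (y i) :=
      (PiLp.volume_preserving_ofLp (Fin N)).integral_comp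
        (MeasurableEquiv.toLp 2 (Fin N → ℝ)).symm.measurableEmbedding
        (fun y : Fin N → ℝ => ∏ i, h i (y i))
    rw [e1, integral_fintype_prod_volume_eq_prod, ← Finset.mul_prod_erase _ _ (Finset.mem_univ i₀)]
    have e2 : ∫ s, h i₀ s = 2 := by
      simp only [hh, if_true]
      rw [integral_indicator measurableSet_Iic, integral_const_mul,
        integral_exp_mul_Iic (by norm_num), ← mul_div_assoc, ← Real.exp_add]
      ring_nf; simp
    have e3 : ∀ i ∈ Finset.univ.erase i₀, ∫ s, h i s = √(4 * Real.pi * r) := by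
      intro i hi
      simp only [hh, if_neg (Finset.ne_of_mem_erase hi)]
      rw [integral_gaussian]
      congr 1; field_simp
    rw [e2, Finset.prod_congr rfl e3, Finset.prod_const, Finset.card_erase_of_mem
      (Finset.mem_univ _), Finset.card_univ, Fintype.card_fin, Real.sqrt_eq_rpow,
      ← Real.rpow_natCast, ← Real.rpow_mul (by positivity), Nat.cast_sub i₀.pos]
    congr 2
    push_cast; ring
  have hle : ∀ x ∈ Metric.closedBall (0 : Space N) r,
      Real.exp (x i₀) ≤ Real.exp r * ∏ i, h i (x i) := by
    intro x hx
    rw [mem_closedBall_zero_iff] at hx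
    have hsq : ∑ i, x i ^ 2 ≤ r ^ 2 := by
      rw [← EuclideanSpace.real_norm_sq_eq]
      exact pow_le_pow_left₀ (norm_nonneg _) hx 2
    rw [← Finset.add_sum_erase _ _ (Finset.mem_univ i₀)] at hsq
    have hnn : 0 ≤ ∑ i ∈ Finset.univ.erase i₀, x i ^ 2 := Finset.sum_nonneg fun i _ => sq_nonneg _
    have hxr : x i₀ ≤ r := (abs_le_of_sq_le_sq' (by linarith : x i₀ ^ 2 ≤ r ^ 2) hr.le).2
    have e3 : ∏ i ∈ Finset.univ.erase i₀, h i (x i) =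
        Real.exp (-(1 / (4 * r)) * ∑ i ∈ Finset.univ.erase i₀, x i ^ 2) := by
      rw [Finset.mul_sum, Real.exp_sum]
      refine Finset.prod_congr rfl fun i hi => ?_
      simp only [hh, if_neg (Finset.ne_of_mem_erase hi)]
    rw [← Finset.mul_prod_erase _ _ (Finset.mem_univ i₀), e3]
    simp only [hh, if_true]
    rw [indicator_of_mem (mem_Iic.2 hxr), ← Real.exp_add, ← Real.exp_add, ← Real.exp_add,
      Real.exp_le_exp]
    set S := ∑ i ∈ Finset.univ.erase i₀, x i ^ 2
    have : 1 / (4 * r) * S ≤ (r - x i₀) / 2 := by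
      rw [one_div_mul_eq_div, div_le_iff₀ (by positivity)]
      nlinarith [sq_nonneg (r - x i₀)]
    linarith
  calc ∫ x in Metric.closedBall (0 : Space N) r, Real.exp (x i₀)
      ≤ ∫ x in Metric.closedBall (0 : Space N) r, Real.exp r * ∏ i, h i (x i) := by
        refine setIntegral_mono_on ?_ (hprod'.const_mul _).integrableOn
          Metric.isClosed_closedBall.measurableSet hle
        exact ContinuousOn.integrableOn_compact (isCompact_closedBall _ _) (by fun_prop)
    _ ≤ ∫ x : Space N, Real.exp r * ∏ i, h i (x i) :=
        setIntegral_le_integral (hprod'.const_mul _) (Filter.Eventually.of_forall fun x =>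
          mul_nonneg (Real.exp_pos _).le (Finset.prod_nonneg fun i _ => hh0 _ _))
    _ = _ := by
        rw [integral_const_mul, hval, Real.mul_rpow (by positivity) hr.le]; ring

/-! ### Lower semicontinuity, supports and Hölder -/

/-- Weighted `p`-integrals are lower semicontinuous on `L²`. -/
theorem lowerSemicontinuous_lintegral_rpow {N : ℕ} {p : ℝ} (hp : 0 ≤ p) {ψ : Space N → ℝ}
    (hψ : Measurable ψ) :
    LowerSemicontinuous fun v : L2 N => ∫⁻ x, ENNReal.ofReal (|v x| ^ p * ψ x) := by
  rw [lowerSemicontinuous_iff_isClosed_preimage]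
  intro c
  refine IsSeqClosed.isClosed fun v v₀ hv hlim => ?_
  obtain ⟨ns, -, hns⟩ := (tendstoInMeasure_of_tendsto_Lp hlim).exists_seq_tendsto_ae
  simp only [mem_preimage, mem_Iic] at hv ⊢
  have hmeas : ∀ n, AEMeasurable (fun x => ENNReal.ofReal (|v n x| ^ p * ψ x)) := fun n =>
    (((Lp.aestronglyMeasurable (v n)).aemeasurable.norm.pow_const p).mul
      hψ.aemeasurable).ennreal_ofReal
  calc ∫⁻ x, ENNReal.ofReal (|v₀ x| ^ p * ψ x)
      ≤ ∫⁻ x, Filter.liminf (fun n => ENNReal.ofReal (|v (ns n) x| ^ p * ψ x)) Filter.atTop := by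
        refine lintegral_mono_ae ?_
        filter_upwards [hns] with x hx
        refine le_of_eq (Filter.Tendsto.liminf_eq ?_).symm
        exact ENNReal.tendsto_ofReal ((hx.abs.rpow_const (Or.inr hp)).mul_const _)
    _ ≤ Filter.liminf (fun n => ∫⁻ x, ENNReal.ofReal (|v (ns n) x| ^ p * ψ x)) Filter.atTop :=
        lintegral_liminf_le' fun n => hmeas (ns n)
    _ ≤ c := Filter.liminf_le_of_le (by isBoundedDefault) fun b hb => by
        obtain ⟨n, hn⟩ := hb.exists
        exact hn.trans (hv _)

/-- An `L²` limit is an almost everywhere limit along a subsequence. This lets support conditions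
pass from difference quotients to the time derivative. -/
theorem isClosed_setOf_ae_eq_zero {N : ℕ} (S : Set (Space N)) :
    IsClosed {v : L2 N | ∀ᵐ x, x ∈ S → v x = 0} := by
  refine IsSeqClosed.isClosed fun v v₀ hv hlim => ?_
  obtain ⟨ns, -, hns⟩ := (tendstoInMeasure_of_tendsto_Lp hlim).exists_seq_tendsto_ae
  have hv' : ∀ᵐ x, ∀ n, x ∈ S → v n x = 0 := ae_all_iff.2 hv
  filter_upwards [hns, hv'] with x hx hx' hxS
  refine tendsto_nhds_unique hx ?_
  simp [fun n => hx' n hxS]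

/-- The weighted Hölder inequality for functions supported in a set `S`. -/
theorem integral_mul_rpow_le {α : Type*} [MeasurableSpace α] {ρ : Measure α} {p M : ℝ}
    (hp : 1 < p) (hM : 0 < M) {v ψ : α → ℝ} {S : Set α} (hS : MeasurableSet S)
    (hψ : ∀ x, 0 ≤ ψ x) (hvS : ∀ᵐ x ∂ρ, x ∉ S → v x = 0)
    (hvψ : Integrable (fun x => v x * ψ x) ρ) (hvp : Integrable (fun x => |v x| ^ p * ψ x) ρ)
    (hψS : IntegrableOn ψ S ρ) (hψM : ∫ x in S, ψ x ∂ρ ≤ M) (h0 : 0 ≤ ∫ x, v x * ψ x ∂ρ) :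
    (∫ x, v x * ψ x ∂ρ) ^ p ≤ (∫ x, |v x| ^ p * ψ x ∂ρ) * M ^ (p - 1) := by
  have hI0 : 0 ≤ ∫ x, |v x| ^ p * ψ x ∂ρ := integral_nonneg fun x =>
    mul_nonneg (Real.rpow_nonneg (abs_nonneg _) _) (hψ x)
  rcases h0.eq_or_lt with h0 | h0
  · rw [← h0, Real.zero_rpow (by linarith)]
    exact mul_nonneg hI0 (Real.rpow_nonneg hM.le _)
  set W := ∫ x, v x * ψ x ∂ρ with hW
  set k := W / M with hk
  have hk0 : 0 < k := div_pos h0 hM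
  -- Tangent line to `a ↦ a^p` at the mean `k = W/M`. Integrating it against `ψ` over `S` gives the
  -- inequality.
  have htan : ∀ a : ℝ, 0 ≤ a → p * k ^ (p - 1) * a - (p - 1) * k ^ p ≤ a ^ p := by
    intro a ha
    have h1 := one_add_mul_self_le_rpow_one_add (s := a / k - 1)
      (by have : 0 ≤ a / k := by positivity
          linarith) hp.le
    rw [add_sub_cancel, Real.div_rpow ha hk0.le, le_div_iff₀ (by positivity)] at h1
    have h2 : k ^ p = k ^ (p - 1) * k := by rw [← Real.rpow_add_one hk0.ne']; ring_nf
    calc _ = (1 + p * (a / k - 1)) * k ^ p := by rw [h2]; field_simp; ring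
      _ ≤ _ := h1
  have hpt : ∀ᵐ x ∂ρ, p * k ^ (p - 1) * (v x * ψ x) - (p - 1) * k ^ p * S.indicator ψ x ≤
      |v x| ^ p * ψ x := by
    filter_upwards [hvS] with x hx
    by_cases hxS : x ∈ S
    · rw [indicator_of_mem hxS]
      have h1 := mul_le_mul_of_nonneg_right (htan _ (abs_nonneg (v x))) (hψ x)
      have h2 : p * k ^ (p - 1) * (v x * ψ x) ≤ p * k ^ (p - 1) * (|v x| * ψ x) := by
        have := hψ x
        gcongr
        exact le_abs_self _
      linarith
    · rw [indicator_of_notMem hxS, hx hxS]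
      have : (0 : ℝ) ≤ |0| ^ p * ψ x := mul_nonneg (Real.rpow_nonneg (abs_nonneg _) _) (hψ x)
      linarith
  have hind : Integrable (S.indicator ψ) ρ := hψS.integrable_indicator hS
  have h3 := integral_mono_ae ((hvψ.const_mul _).sub (hind.const_mul _)) hvp hpt
  rw [integral_sub' (hvψ.const_mul _) (hind.const_mul _), integral_const_mul, integral_const_mul,
    integral_indicator hS, ← hW] at h3
  have h4 : (p - 1) * k ^ p * ∫ x in S, ψ x ∂ρ ≤ (p - 1) * k ^ p * M := by
    have : 0 ≤ p - 1 := by linarith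
    gcongr
  have h5 : k ^ p * M = k ^ (p - 1) * W := by
    have h2 : k ^ p = k ^ (p - 1) * k := by rw [← Real.rpow_add_one hk0.ne']; ring_nf
    rw [h2, hk]; field_simp
  have h6 : k ^ (p - 1) * W ≤ ∫ x, |v x| ^ p * ψ x ∂ρ := by nlinarith
  have h7 : k ^ (p - 1) * W = W ^ p / M ^ (p - 1) := by
    rw [hk, Real.div_rpow h0.le hM.le]
    have : W ^ p = W ^ (p - 1) * W := by rw [← Real.rpow_add_one h0.ne']; ring_nf
    rw [this]; ring
  rwa [h7, div_le_iff₀ (by positivity)] at h6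

/-! ### Test functions and propagation of the support -/

theorem laplacian_exp_coord {N : ℕ} (i₀ : Fin N) (x : Space N) :
    Laplacian.laplacian (fun y : Space N => Real.exp (y i₀)) x = Real.exp (x i₀) := by
  set ℓ : Space N →L[ℝ] ℝ := EuclideanSpace.proj i₀ with hℓ
  have h1 : fderiv ℝ (fun y : Space N => Real.exp (y i₀)) = fun y => Real.exp (y i₀) • ℓ := by
    ext1 y
    exact ((ℓ.hasFDerivAt (x := y)).exp).fderiv
  have h2 : fderiv ℝ (fun y : Space N => Real.exp (y i₀) • ℓ) x =
      (Real.exp (x i₀) • ℓ).smulRight ℓ :=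
    (((ℓ.hasFDerivAt (x := x)).exp).smul_const ℓ).fderiv
  rw [InnerProductSpace.laplacian_eq_iteratedFDeriv_orthonormalBasis _
    (EuclideanSpace.basisFun (Fin N) ℝ)]
  simp only [iteratedFDeriv_two_apply, h1, h2]
  rw [Finset.sum_eq_single i₀ (fun i _ hi => by simp [hℓ, hi.symm]) (by simp)]
  simp [hℓ]

/-- A nonnegative compactly supported smooth function agreeing with a plane wave on a ball. -/
theorem exists_plane_wave_cutoff {N : ℕ} (i₀ : Fin N) {r : ℝ} (hr : 0 < r) :
    ∃ ψ : Space N → ℝ, ContDiff ℝ ∞ ψ ∧ HasCompactSupport ψ ∧ (∀ x, 0 ≤ ψ x) ∧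
      ∀ x, ‖x‖ ≤ r → ψ x = Real.exp (x i₀) ∧ Laplacian.laplacian ψ x = Real.exp (x i₀) := by
  -- The bump equals 1 beyond radius `r`, so the Laplacians also agree on the boundary sphere.
  set χ : ContDiffBump (0 : Space N) := ⟨r + 1, r + 2, by linarith, by linarith⟩ with hχ
  refine ⟨fun x => Real.exp (x i₀) * χ x, ?_, ?_, ?_, ?_⟩
  · exact ContDiff.mul (by fun_prop) χ.contDiff
  · exact χ.hasCompactSupport.mul_left
  · exact fun x => mul_nonneg (Real.exp_pos _).le χ.nonneg
  · intro x hx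
    have h1 : ∀ y ∈ Metric.closedBall (0 : Space N) (r + 1),
        Real.exp (y i₀) * χ y = Real.exp (y i₀) := fun y hy => by
      rw [χ.one_of_mem_closedBall hy, mul_one]
    refine ⟨h1 x (mem_closedBall_zero_iff.2 (by linarith)), ?_⟩
    rw [← laplacian_exp_coord i₀ x]
    refine (InnerProductSpace.laplacian_congr_nhds ?_).self_of_nhds
    refine Filter.eventually_of_mem (Metric.closedBall_mem_nhds_of_mem (x := x) ?_) h1
    exact mem_ball_zero_iff.2 (by linarith)

theorem exists_time_cutoff {T : EReal} {t₁ : ℝ} (h1 : 1 < t₁) (hT : (t₁ : EReal) < T) :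
    ∃ η : ℝ → ℝ, ContDiff ℝ ∞ η ∧ HasCompactSupport η ∧ (∀ t ∈ tsupport η, (t : EReal) < T) ∧
      ∀ t ∈ Icc 1 t₁, η t = 1 ∧ deriv η t = 0 := by
  obtain ⟨t₂, ht₁, ht₂⟩ := EReal.lt_iff_exists_real_btwn.1 hT
  have ht₁' : t₁ < t₂ := EReal.coe_lt_coe_iff.1 ht₁
  set d := (t₂ - t₁) / 3 with hd
  have hd0 : 0 < d := by simp only [hd]; linarith
  set χ : ContDiffBump (1 : ℝ) := ⟨t₁ - 1 + d, t₁ - 1 + 2 * d, by linarith, by linarith⟩ with hχ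
  refine ⟨χ, χ.contDiff, χ.hasCompactSupport, fun t ht => ?_, fun t ht => ?_⟩
  · rw [χ.tsupport_eq, Real.closedBall_eq_Icc] at ht
    refine lt_of_le_of_lt (EReal.coe_le_coe_iff.2 ?_) ht₂
    have : t ≤ 1 + (t₁ - 1 + 2 * d) := ht.2
    simp only [hd] at this
    linarith
  · have hmem : t ∈ Metric.ball (1 : ℝ) χ.rIn := by
      rw [Real.ball_eq_Ioo]
      constructor
      · have : χ.rIn = t₁ - 1 + d := rfl
        linarith [ht.1]
      · have : χ.rIn = t₁ - 1 + d := rfl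
        linarith [ht.2]
    have hev := χ.eventuallyEq_one_of_mem_ball hmem
    refine ⟨hev.self_of_nhds, ?_⟩
    rw [hev.deriv_eq]
    simp

theorem isTest_mul {N : ℕ} {T : EReal} {η : ℝ → ℝ} {ψ : Space N → ℝ} (hη : ContDiff ℝ ∞ η)
    (hη' : HasCompactSupport η) (hηT : ∀ t ∈ tsupport η, (t : EReal) < T) (hψ : ContDiff ℝ ∞ ψ)
    (hψ' : HasCompactSupport ψ) : IsTest T fun z : ℝ × Space N => η z.1 * ψ z.2 := by
  have hsub : tsupport (fun z : ℝ × Space N => η z.1 * ψ z.2) ⊆ tsupport η ×ˢ tsupport ψ := by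
    refine closure_minimal (fun z hz => ?_) ((isClosed_tsupport _).prod (isClosed_tsupport _))
    have hz' : η z.1 * ψ z.2 ≠ 0 := hz
    exact ⟨subset_tsupport _ (left_ne_zero_of_mul hz'), subset_tsupport _ (right_ne_zero_of_mul hz')⟩
  refine ⟨(hη.comp contDiff_fst).mul (hψ.comp contDiff_snd), ?_, fun z hz => hηT _ (hsub hz).1⟩
  exact (hη'.isCompact.prod hψ'.isCompact).of_isClosed_subset (isClosed_tsupport _) hsub

theorem mem_timeInterval_of_le {T : EReal} {t₁ t : ℝ} (hT : (t₁ : EReal) < T)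
    (ht : t ∈ Icc 1 t₁) : t ∈ timeInterval T :=
  ⟨ht.1, lt_of_le_of_lt (EReal.coe_le_coe_iff.2 ht.2) hT⟩

theorem timeInterval_mem_nhds {T : EReal} {t₁ t : ℝ} (hT : (t₁ : EReal) < T)
    (ht : t ∈ Ioo 1 t₁) : timeInterval T ∈ nhds t :=
  Filter.mem_of_superset (Icc_mem_nhds ht.1 ht.2) fun _ hs => mem_timeInterval_of_le hT hs

theorem uniqueDiffOn_timeInterval {T : EReal} {t₁ : ℝ} (h1 : 1 < t₁) (hT : (t₁ : EReal) < T) :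
    UniqueDiffOn ℝ (timeInterval T) := by
  refine uniqueDiffOn_convex (OrdConnected.convex ⟨fun x hx y hy z hz => ?_⟩) ?_
  · exact ⟨hx.1.trans hz.1, lt_of_le_of_lt (EReal.coe_le_coe_iff.2 hz.2) hy.2⟩
  · refine ⟨(1 + t₁) / 2, mem_interior_iff_mem_nhds.2 (timeInterval_mem_nhds hT ?_)⟩
    constructor <;> linarith

theorem phi_mono {m s t : ℝ} (hm : 0 ≤ m) (hs : 0 ≤ s) (hst : s ≤ t) : phi m s ≤ phi m t := by
  unfold phi
  gcongr

/-- The velocity is supported in the light cone as well. -/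
theorem ae_timeDeriv_eq_zero {N : ℕ} {m R : ℝ} (hm : 0 ≤ m) {T : EReal} {u : ℝ → L2 N}
    {t₁ t : ℝ} (hT : (t₁ : EReal) < T) (hu : ContDiffOn ℝ 1 u (timeInterval T))
    (hc : SupportedInCone m R T u) (ht : t ∈ Ioo 1 t₁) :
    ∀ᵐ x : Space N, R + phi m t - phi m 1 < ‖x‖ → timeDeriv T u t x = 0 := by
  have htm : t ∈ timeInterval T := mem_timeInterval_of_le hT (Ioo_subset_Icc_self ht)
  have hd : HasDerivAt u (timeDeriv T u t) t :=
    ((hu.differentiableOn one_ne_zero t htm).hasDerivWithinAt).hasDerivAt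
      (timeInterval_mem_nhds hT ht)
  -- Left difference quotients are used because earlier cone sections are smaller, so each quotient
  -- is already supported in the section at time `t`.
  have hs := (hasDerivWithinAt_iff_tendsto_slope' (s := Iio t) (by simp)).1 hd.hasDerivWithinAt
  refine (isClosed_setOf_ae_eq_zero {x : Space N | R + phi m t - phi m 1 < ‖x‖}).mem_of_tendsto hs ?_
  filter_upwards [Ioo_mem_nhdsLT ht.1] with s hs
  have hsm : s ∈ timeInterval T := mem_timeInterval_of_le hT ⟨hs.1.le, hs.2.le.trans ht.2.le⟩
  have hφ := phi_mono hm (by linarith [hs.1]) hs.2.le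
  simp only [slope_def_module]
  filter_upwards [hc t htm, hc s hsm, Lp.coeFn_smul (s - t)⁻¹ (u s - u t),
    Lp.coeFn_sub (u s) (u t)] with x h1 h2 h3 h4 hx
  rw [h3, Pi.smul_apply, h4, Pi.sub_apply, h1 hx, h2 (by linarith)]
  simp

/-! ### Averaging an energy solution -/

/-- Pairing of `L²` functions with a fixed compactly supported continuous function. -/
theorem exists_pairing {N : ℕ} {ψ : Space N → ℝ} (hψ : Continuous ψ) (hψ' : HasCompactSupport ψ) :
    ∃ ℓ : L2 N →L[ℝ] ℝ, ∀ f : L2 N, ℓ f = ∫ x, f x * ψ x ∧ Integrable fun x => f x * ψ x := by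
  have hmem : MemLp ψ 2 (volume : Measure (Space N)) := hψ.memLp_of_hasCompactSupport hψ'
  have hae : ∀ f : L2 N, (fun x => inner ℝ (hmem.toLp ψ x) (f x)) =ᵐ[volume]
      fun x => f x * ψ x := fun f => by
    filter_upwards [hmem.coeFn_toLp] with x hx
    simp [hx]
  refine ⟨innerSL ℝ (hmem.toLp ψ), fun f => ⟨?_, ?_⟩⟩
  · rw [innerSL_apply_apply, L2.inner_def]
    exact integral_congr_ae (hae f)
  · exact (L2.integrable_inner (hmem.toLp ψ) f).congr (hae f)

theorem integral_mul_congr_of_ae_eq_zero {N : ℕ} {ψ χ : Space N → ℝ} {f : L2 N} {r : ℝ}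
    (hf : ∀ᵐ x, r < ‖x‖ → f x = 0) (h : ∀ x, ‖x‖ ≤ r → ψ x = χ x) :
    ∫ x, f x * ψ x = ∫ x, f x * χ x := by
  refine integral_congr_ae ?_
  filter_upwards [hf] with x hx
  rcases le_or_gt ‖x‖ r with h1 | h1
  · simp only [h x h1]
  · simp [hx h1]

/-- The source in the averaged equation is measurable, finite for almost every time, and
integrable. -/
theorem integrable_source {N : ℕ} {p : ℝ} (hp : 0 ≤ p) {ψ : Space N → ℝ} (hψ : Measurable ψ)
    (hψ0 : ∀ x, 0 ≤ ψ x) {a b : ℝ} {v : ℝ → L2 N} (hv : ContinuousOn v (Icc a b))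
    (hfin : ∫⁻ s in Ioc a b, ∫⁻ x, ENNReal.ofReal (|v s x| ^ p * ψ x) < ⊤) :
    IntegrableOn (fun s => ∫ x, |v s x| ^ p * ψ x) (Ioc a b) ∧
      ∀ᵐ s, s ∈ Ioc a b → Integrable fun x => |v s x| ^ p * ψ x := by
  borelize (L2 N)
  -- A lower semicontinuous function on `L²` composed with a continuous curve is measurable; no
  -- joint measurability of the representatives in time and space is needed.
  have hmeas : AEMeasurable (fun s => ∫⁻ x, ENNReal.ofReal (|v s x| ^ p * ψ x))
      (volume.restrict (Ioc a b)) :=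
    (lowerSemicontinuous_lintegral_rpow hp hψ).measurable.comp_aemeasurable
      ((hv.mono Ioc_subset_Icc_self).aemeasurable measurableSet_Ioc)
  have hsm : ∀ s, AEStronglyMeasurable (fun x => |v s x| ^ p * ψ x) volume := fun s =>
    (((Lp.aestronglyMeasurable (v s)).aemeasurable.norm.pow_const p).mul
      hψ.aemeasurable).aestronglyMeasurable
  have hnn : ∀ s x, 0 ≤ |v s x| ^ p * ψ x := fun s x =>
    mul_nonneg (Real.rpow_nonneg (abs_nonneg _) _) (hψ0 x)
  constructor
  · refine (integrable_toReal_of_lintegral_ne_top hmeas hfin.ne).congr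
      (Filter.Eventually.of_forall fun s => ?_)
    exact (integral_eq_lintegral_of_nonneg_ae (Filter.Eventually.of_forall (hnn s)) (hsm s)).symm
  · have := ae_lt_top' hmeas hfin.ne
    rw [ae_restrict_iff' measurableSet_Ioc] at this
    filter_upwards [this] with s hs hsI
    exact ⟨hsm s, (hasFiniteIntegral_iff_ofReal (Filter.Eventually.of_forall (hnn s))).2 (hs hsI)⟩

/-- The average of an energy solution against a plane wave solves the damped equation with a source
controlled from below by a power of the velocity. -/
theorem exists_dampedODE {N : ℕ} (i₀ : Fin N) {m μ ν p R ε : ℝ} (hm : 0 ≤ m) (hp : 1 < p)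
    (hR : 0 < R) {u₀ u₁ : L2 N} (hs₀ : ∀ᵐ x : Space N, R < ‖x‖ → u₀ x = 0)
    (hs₁ : ∀ᵐ x : Space N, R < ‖x‖ → u₁ x = 0) {T : EReal} {u : ℝ → L2 N}
    (hu : IsEnergySolution m μ ν p ε u₀ u₁ T u) (hc : SupportedInCone m R T u) {t₁ : ℝ}
    (h1 : 1 < t₁) (hT : (t₁ : EReal) < T) :
    ∃ w g f : ℝ → ℝ, DampedODE m μ ν t₁ w g f ∧ w 1 = ε * ∫ x, u₀ x * Real.exp (x i₀) ∧
      g 1 = ε * ∫ x, u₁ x * Real.exp (x i₀) ∧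
      ∀ M : ℝ → ℝ, (∀ s ∈ Icc 1 t₁, 0 < M s ∧
        ∫ x in Metric.closedBall (0 : Space N) (R + phi m s - phi m 1), Real.exp (x i₀) ≤ M s) →
        ∀ᵐ s, s ∈ Icc 1 t₁ → 0 ≤ g s → g s ^ p ≤ f s * M s ^ (p - 1) := by
  have hφ : ∀ s ∈ Icc 1 t₁, R ≤ R + phi m s - phi m 1 ∧
      R + phi m s - phi m 1 ≤ R + phi m t₁ - phi m 1 := fun s hs => by
    have e1 := phi_mono hm zero_le_one hs.1
    have e2 := phi_mono hm (by linarith [hs.1]) hs.2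
    constructor <;> linarith
  set r := R + phi m t₁ - phi m 1 with hr
  have hRr : R ≤ r := (hφ t₁ ⟨h1.le, le_rfl⟩).1
  have hr0 : 0 < r := hR.trans_le hRr
  obtain ⟨ψ, hψ, hψc, hψ0, hψe⟩ := exists_plane_wave_cutoff i₀ hr0
  obtain ⟨η, hη, hηc, hηT, hη1⟩ := exists_time_cutoff h1 hT
  obtain ⟨ℓ, hℓ⟩ := exists_pairing hψ.continuous hψc
  have hmem : ∀ {t}, t ∈ Icc 1 t₁ → t ∈ timeInterval T := fun ht => mem_timeInterval_of_le hT ht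
  have hsub : Icc 1 t₁ ⊆ timeInterval T := fun t ht => hmem ht
  set v := timeDeriv T u with hv
  have hvc : ContinuousOn v (Icc 1 t₁) :=
    (hu.contDiff_L2.continuousOn_derivWithin (uniqueDiffOn_timeInterval h1 hT) le_rfl).mono hsub
  have huc : ContinuousOn u (Icc 1 t₁) := hu.contDiff_L2.continuousOn.mono hsub
  have htest : IsTest T fun z : ℝ × Space N => η z.1 * ψ z.2 := isTest_mul hη hηc hηT hψ hψc
  have hI1 : ∀ {t}, t ∈ Icc 1 t₁ → uIcc 1 t = Icc 1 t := fun ht => uIcc_of_le ht.1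
  have hucone : ∀ t ∈ Icc 1 t₁, ∀ᵐ x, r < ‖x‖ → u t x = 0 := fun t ht => by
    filter_upwards [hc t (hmem ht)] with x hx hx'
    exact hx ((hφ t ht).2.trans_lt hx')
  have hfin : ∫⁻ s in Ioc 1 t₁, ∫⁻ x, ENNReal.ofReal (|v s x| ^ p * ψ x) < ⊤ := by
    refine lt_of_le_of_lt (le_of_eq ?_) (hu.integrable _ htest t₁ (hmem ⟨h1.le, le_rfl⟩))
    refine setLIntegral_congr_fun measurableSet_Ioc fun s hs => ?_
    simp only [(hη1 s ⟨hs.1.le, hs.2⟩).1, one_mul, abs_of_nonneg (hψ0 _), hv]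
  obtain ⟨hfint, hfae⟩ := integrable_source (by linarith : 0 ≤ p) hψ.continuous.measurable hψ0 hvc hfin
  set f : ℝ → ℝ := fun s => ∫ x, |v s x| ^ p * ψ x with hf
  have hrp : ∀ q : ℝ, ContinuousOn (fun s : ℝ => s ^ q) (Icc 1 t₁) := fun q =>
    continuousOn_id.rpow_const fun s hs => Or.inl (by have h2 := hs.1; simp only [id]; linarith)
  have hsource : IntervalIntegrable (fun s => s ^ μ * f s) volume 1 t₁ := by
    refine IntervalIntegrable.continuousOn_mul ?_ (by rw [uIcc_of_le h1.le]; exact hrp μ)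
    rwa [intervalIntegrable_iff_integrableOn_Ioc_of_le h1.le]
  have hwc : ContinuousOn (fun t => ℓ (u t)) (Icc 1 t₁) := ℓ.continuous.comp_continuousOn huc
  have hweak : ∀ t ∈ Icc 1 t₁, t ^ μ * ℓ (v t) = ε * ℓ u₁ +
      ∫ s in (1 : ℝ)..t, ((s ^ (2 * m) * s ^ μ - ν ^ 2 * s ^ μ / s ^ 2) * ℓ (u s)
        + s ^ μ * f s) := by
    intro t ht
    have hsubt : Icc 1 t ⊆ Icc 1 t₁ := Icc_subset_Icc le_rfl ht.2
    have key := hu.weak _ htest t (hmem ht)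
    have e1 : ∫ x, v t x * (η t * ψ x) = ℓ (v t) := by
      rw [(hη1 t ht).1, (hℓ _).1]; simp
    have e2 : ∫ x, u₁ x * (η 1 * ψ x) = ℓ u₁ := by
      rw [(hη1 1 ⟨le_rfl, h1.le⟩).1, (hℓ _).1]; simp
    -- The cutoff `η` is constant on `[1, t₁]`, so the term with `Φ_t` drops out.
    have e3 : ∫ s in (1 : ℝ)..t, s ^ μ * ∫ x, v s x *
        testDt (fun z : ℝ × Space N => η z.1 * ψ z.2) s x = 0 := by
      rw [intervalIntegral.integral_congr (g := fun _ => 0), intervalIntegral.integral_zero]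
      intro s hs
      rw [hI1 ht] at hs
      have : ∀ x, testDt (fun z : ℝ × Space N => η z.1 * ψ z.2) s x = 0 := fun x => by
        simp only [testDt]
        rw [deriv_mul_const_field, (hη1 s (hsubt hs)).2, zero_mul]
      simp [this]
    have e4 : ∫ s in (1 : ℝ)..t, s ^ (2 * m) * s ^ μ * ∫ x, u s x *
        testLaplacian (fun z : ℝ × Space N => η z.1 * ψ z.2) s x =
        ∫ s in (1 : ℝ)..t, s ^ (2 * m) * s ^ μ * ℓ (u s) := by
      refine intervalIntegral.integral_congr fun s hs => ?_
      rw [hI1 ht] at hs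
      have e5 : (fun y => testLaplacian (fun z : ℝ × Space N => η z.1 * ψ z.2) s y) =
          fun x => Laplacian.laplacian ψ x := by
        ext x
        simp only [testLaplacian, (hη1 s (hsubt hs)).1, one_mul]
      simp only [congrFun e5]
      -- The Laplacian of `ψ` equals `ψ` only on the ball of radius `r`; the support of `u s` lies
      -- there.
      rw [(hℓ _).1, integral_mul_congr_of_ae_eq_zero (hucone s (hsubt hs))
        fun x hx => (hψe x hx).2.trans (hψe x hx).1.symm]
    have e6 : ∫ s in (1 : ℝ)..t, ν ^ 2 * s ^ μ / s ^ 2 * ∫ x, u s x * (η s * ψ x) =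
        ∫ s in (1 : ℝ)..t, ν ^ 2 * s ^ μ / s ^ 2 * ℓ (u s) := by
      refine intervalIntegral.integral_congr fun s hs => ?_
      rw [hI1 ht] at hs
      simp only [(hη1 s (hsubt hs)).1, one_mul, (hℓ _).1]
    have e7 : ∫ s in (1 : ℝ)..t, s ^ μ * ∫ x, |v s x| ^ p * (η s * ψ x) =
        ∫ s in (1 : ℝ)..t, s ^ μ * f s := by
      refine intervalIntegral.integral_congr fun s hs => ?_
      rw [hI1 ht] at hs
      simp only [(hη1 s (hsubt hs)).1, one_mul, hf]
    simp only [← hv] at key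
    rw [e1, e2, e3, e4, e6, e7] at key
    have hi : ∀ {q : ℝ → ℝ}, ContinuousOn q (Icc 1 t₁) → IntervalIntegrable q volume 1 t :=
      fun hq => ContinuousOn.intervalIntegrable (by rw [hI1 ht]; exact hq.mono hsubt)
    have i1 : IntervalIntegrable (fun s => s ^ (2 * m) * s ^ μ * ℓ (u s)) volume 1 t :=
      hi (((hrp _).mul (hrp _)).mul hwc)
    have i2 : IntervalIntegrable (fun s => ν ^ 2 * s ^ μ / s ^ 2 * ℓ (u s)) volume 1 t := by
      refine hi (((continuousOn_const.mul (hrp _)).div (continuousOn_id.pow 2)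
        fun s hs => ?_).mul hwc)
      have : 0 < s := by linarith [hs.1]
      simpa using this.ne'
    have i3 : IntervalIntegrable (fun s => s ^ μ * f s) volume 1 t :=
      hsource.mono_set (by rw [hI1 ht, uIcc_of_le h1.le]; exact hsubt)
    have e8 : ∫ s in (1 : ℝ)..t, ((s ^ (2 * m) * s ^ μ - ν ^ 2 * s ^ μ / s ^ 2) * ℓ (u s)
        + s ^ μ * f s) = (∫ s in (1 : ℝ)..t, s ^ (2 * m) * s ^ μ * ℓ (u s))
        - (∫ s in (1 : ℝ)..t, ν ^ 2 * s ^ μ / s ^ 2 * ℓ (u s))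
        + ∫ s in (1 : ℝ)..t, s ^ μ * f s := by
      rw [← intervalIntegral.integral_sub i1 i2, ← intervalIntegral.integral_add (i1.sub i2) i3]
      simp only [sub_mul]
    rw [e8]
    linarith
  have hg1 : ℓ (v 1) = ε * ℓ u₁ := by
    have := hweak 1 ⟨le_rfl, h1.le⟩
    simpa using this
  have hℓe : ∀ f₀ : L2 N, (∀ᵐ x : Space N, R < ‖x‖ → f₀ x = 0) →
      ℓ f₀ = ∫ x, f₀ x * Real.exp (x i₀) := fun f₀ hf₀ => by
    rw [(hℓ _).1]
    exact integral_mul_congr_of_ae_eq_zero hf₀ fun x hx => (hψe x (hx.trans hRr)).1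
  refine ⟨fun t => ℓ (u t), fun t => ℓ (v t), f, ⟨h1.le, hwc, ℓ.continuous.comp_continuousOn hvc,
    ?_, fun t => integral_nonneg fun x => mul_nonneg (Real.rpow_nonneg (abs_nonneg _) _) (hψ0 x),
    hsource, ?_⟩, ?_, ?_, ?_⟩
  · intro t ht
    have hd : HasDerivAt u (v t) t := ((hu.contDiff_L2.differentiableOn one_ne_zero t
      (hmem (Ioo_subset_Icc_self ht))).hasDerivWithinAt).hasDerivAt (timeInterval_mem_nhds hT ht)
    exact ℓ.hasFDerivAt.comp_hasDerivAt t hd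
  · intro t ht
    rw [hg1]
    exact hweak t ht
  · simp only [hu.initial, map_smul, smul_eq_mul, hℓe u₀ hs₀]
  · simp only [hg1, hℓe u₁ hs₁]
  · intro M hM
    filter_upwards [hfae, Measure.ae_ne volume 1, Measure.ae_ne volume t₁] with s hs hs1 hst hsI hg0
    have hsI' : s ∈ Ioo 1 t₁ := ⟨lt_of_le_of_ne hsI.1 hs1.symm, lt_of_le_of_ne hsI.2 hst⟩
    have hcone := ae_timeDeriv_eq_zero hm hT hu.contDiff_L2 hc hsI'
    obtain ⟨hM0, hM1⟩ := hM s hsI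
    have hball : ∀ x ∈ Metric.closedBall (0 : Space N) (R + phi m s - phi m 1),
        ψ x = Real.exp (x i₀) := fun x hx =>
      (hψe x ((mem_closedBall_zero_iff.1 hx).trans (hφ s hsI).2)).1
    simp only [(hℓ _).1] at hg0 ⊢
    refine integral_mul_rpow_le (S := Metric.closedBall 0 (R + phi m s - phi m 1)) hp hM0 Metric.isClosed_closedBall.measurableSet hψ0 ?_ (hℓ _).2
      (hs ⟨hsI'.1, hsI.2⟩)
      (hψ.continuous.continuousOn.integrableOn_compact (isCompact_closedBall _ _)) ?_ hg0
    · filter_upwards [hcone] with x hx hxS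
      exact hx (by simpa using hxS)
    · rwa [setIntegral_congr_fun Metric.isClosed_closedBall.measurableSet hball]

/-- Positivity of the averaged data. -/
theorem averaged_data_pos {N : ℕ} (i₀ : Fin N) {μ ν R : ℝ} (hR : 0 < R) {u₀ u₁ : L2 N}
    (hd : AdmissibleData μ ν R u₀ u₁) :
    0 ≤ ∫ x, u₀ x * Real.exp (x i₀) ∧
      eulerExponent μ ν * ∫ x, u₀ x * Real.exp (x i₀) < ∫ x, u₁ x * Real.exp (x i₀) := by
  obtain ⟨ψ, hψ, hψc, hψ0, hψe⟩ := exists_plane_wave_cutoff i₀ hR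
  obtain ⟨ℓ, hℓ⟩ := exists_pairing hψ.continuous hψc
  have hint : ∀ f : L2 N, (∀ᵐ x : Space N, R < ‖x‖ → f x = 0) →
      Integrable fun x => f x * Real.exp (x i₀) := fun f hf => by
    refine (hℓ f).2.congr ?_
    filter_upwards [hf] with x hx
    rcases le_or_gt ‖x‖ R with h1 | h1
    · simp only [(hψe x h1).1]
    · simp [hx h1]
  refine ⟨integral_nonneg_of_ae ?_, ?_⟩
  · filter_upwards [hd.nonneg₀] with x hx
    exact mul_nonneg hx (Real.exp_pos _).le
  have hi0 := hint u₀ hd.supp₀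
  have hi1 := hint u₁ hd.supp₁
  set κ := eulerExponent μ ν with hκ
  have hk : (μ - 1 - √(discr μ ν)) / 2 = -κ := by rw [hκ, eulerExponent]; ring
  have hpt : ∀ᵐ x : Space N, 0 ≤ u₁ x * Real.exp (x i₀) - κ * (u₀ x * Real.exp (x i₀)) ∧
      (u₁ x * Real.exp (x i₀) - κ * (u₀ x * Real.exp (x i₀)) = 0 → u₀ x = 0 ∧ u₁ x = 0) := by
    filter_upwards [hd.pos] with x hx
    rw [hk] at hx
    by_cases h : u₀ x ≠ 0 ∨ u₁ x ≠ 0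
    · have h1 : 0 < u₁ x * Real.exp (x i₀) - κ * (u₀ x * Real.exp (x i₀)) := by
        rw [show u₁ x * Real.exp (x i₀) - κ * (u₀ x * Real.exp (x i₀)) =
          (-κ * u₀ x + u₁ x) * Real.exp (x i₀) by ring]
        exact mul_pos (hx h) (Real.exp_pos _)
      exact ⟨h1.le, fun h2 => absurd h2 h1.ne'⟩
    · push Not at h
      simp [h.1, h.2]
  have hi := hi1.sub (hi0.const_mul κ)
  rw [← sub_pos, ← integral_const_mul, ← integral_sub hi1 (hi0.const_mul κ)]
  -- If the integral vanished, so would its nonnegative integrand, which is positive wherever the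
  -- data are not both zero; the data would be trivial.
  refine lt_of_le_of_ne (integral_nonneg_of_ae (hpt.mono fun x hx => hx.1)) fun h => ?_
  have hz := (integral_eq_zero_iff_of_nonneg_ae (hpt.mono fun x hx => hx.1) hi).1 h.symm
  have hu : u₀ = 0 ∧ u₁ = 0 := by
    constructor
    · rw [Lp.eq_zero_iff_ae_eq_zero]
      filter_upwards [hz, hpt] with x h1 h2 using (h2.2 h1).1
    · rw [Lp.eq_zero_iff_ae_eq_zero]
      filter_upwards [hz, hpt] with x h1 h2 using (h2.2 h1).2
  rcases hd.nontrivial with h0 | h0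
  · exact h0 hu.1
  · exact h0 hu.2

theorem exists_cone_integral_le {N : ℕ} (i₀ : Fin N) {m R : ℝ} (hm : 0 ≤ m) (hR : 0 < R) :
    ∃ D : ℝ, 0 < D ∧ ∀ s : ℝ, 1 ≤ s →
      ∫ x in Metric.closedBall (0 : Space N) (R + phi m s - phi m 1), Real.exp (x i₀) ≤
        D * s ^ ((1 + m) * (((N : ℝ) - 1) / 2)) * Real.exp (phi m s) := by
  obtain ⟨D, hD, h⟩ := exists_setIntegral_exp_le i₀
  have hN : (1 : ℝ) ≤ N := by exact_mod_cast i₀.pos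
  refine ⟨D * (R + 1) ^ (((N : ℝ) - 1) / 2) * Real.exp R, by positivity, fun s hs => ?_⟩
  have e1 := phi_mono hm zero_le_one hs
  have e2 : 0 ≤ phi m 1 := by unfold phi; positivity
  have hs1 : 1 ≤ s ^ (1 + m) := Real.one_le_rpow hs (by linarith)
  have e3 : phi m s ≤ s ^ (1 + m) := div_le_self (by positivity) (by linarith)
  have hr : R + phi m s - phi m 1 ≤ (R + 1) * s ^ (1 + m) := by nlinarith
  have hr0 : 0 < R + phi m s - phi m 1 := by linarith
  calc _ ≤ _ := h _ hr0
    _ ≤ D * ((R + 1) * s ^ (1 + m)) ^ (((N : ℝ) - 1) / 2) * Real.exp (R + phi m s) := by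
      have e4 := Real.rpow_le_rpow hr0.le hr (by linarith : 0 ≤ ((N : ℝ) - 1) / 2)
      have e5 : R + phi m s - phi m 1 ≤ R + phi m s := by linarith
      gcongr
    _ = _ := by
      rw [Real.mul_rpow (by positivity) (by positivity), Real.rpow_mul (by linarith), Real.exp_add]
      ring

/-! ### Lifespan bounds -/

/-- Upper bound for the existence time of energy solutions, in implicit form. -/
theorem exists_integral_bound_of_energySolution {N : ℕ} (hN : 1 ≤ N) {m μ ν p R : ℝ} (hm : 0 ≤ m)
    (hμ : 0 ≤ μ) (hδ : 0 ≤ discr μ ν) (hp : 1 < p) (hR : 0 < R) {u₀ u₁ : L2 N}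
    (hdata : AdmissibleData μ ν R u₀ u₁) :
    ∃ T₀ : ℝ, 1 ≤ T₀ ∧ ∃ K : ℝ, 0 < K ∧ ∀ ε : ℝ, 0 < ε → ∀ (T : EReal) (u : ℝ → L2 N),
      IsEnergySolution m μ ν p ε u₀ u₁ T u → SupportedInCone m R T u → ∀ t₁ : ℝ, T₀ < t₁ →
      (t₁ : EReal) < T →
      ∫ s in T₀..t₁, s ^ (-(((1 + m) * ((N : ℝ) - 1) - m + μ) * (p - 1) / 2)) ≤
        K * ε ^ (-(p - 1)) := by
  set i₀ : Fin N := ⟨0, hN⟩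
  obtain ⟨D, hD, hcone⟩ := exists_cone_integral_le i₀ hm hR
  obtain ⟨hA₀, hA⟩ := averaged_data_pos i₀ hR hdata
  obtain ⟨T₀, hT₀, K, hK, h⟩ := exists_integral_rpow_neg_le (m := m) (μ := μ) (ν := ν)
    (σ := (1 + m) * (((N : ℝ) - 1) / 2)) hm hμ hδ hp hA₀ hA hD
  refine ⟨T₀, hT₀, K, hK, fun ε hε T u hu hc t₁ ht₁ hT => ?_⟩
  obtain ⟨w, g, f, hode, hw, hg, hf⟩ := exists_dampedODE i₀ hm hp hR hdata.supp₀ hdata.supp₁ hu hc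
    (hT₀.trans_lt ht₁) hT
  have := h ε hε t₁ w g f ht₁.le hode hw hg (hf _ fun s hs => ⟨?_, hcone s hs.1⟩)
  · convert this using 5
    ring
  · have : 0 < s := by linarith [hs.1]
    positivity

theorem lifespan_le_of_forall {N : ℕ} {m μ ν p R ε B T₀ : ℝ} {u₀ u₁ : L2 N} (hB : T₀ ≤ B)
    (h : ∀ (T : EReal) (u : ℝ → L2 N), IsEnergySolution m μ ν p ε u₀ u₁ T u →
      SupportedInCone m R T u → ∀ t₁ : ℝ, T₀ < t₁ → (t₁ : EReal) < T → t₁ ≤ B) :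
    lifespan m μ ν p R ε u₀ u₁ ≤ (B : EReal) := by
  refine sSup_le ?_
  rintro T ⟨-, u, hu, hc⟩
  by_contra! hcon
  obtain ⟨t, ht₁, ht₂⟩ := EReal.lt_iff_exists_real_btwn.1 hcon
  have ht : B < t := EReal.coe_lt_coe_iff.1 ht₁
  exact absurd (h T u hu hc t (hB.trans_lt ht) ht₂) (not_le.2 ht)

theorem one_le_rpow_neg {ε q : ℝ} (hε : 0 < ε) (hε1 : ε ≤ 1) (hq : 0 ≤ q) : 1 ≤ ε ^ (-q) :=
  Real.one_le_rpow_of_pos_of_le_one_of_nonpos hε hε1 (by linarith)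

/-- With `β = 1 - k/2 > 0` the integral equals `(t₁^β - T₀^β)/β`. For `ε ≤ 1` the term `T₀^β` is
absorbed into a multiple of `ε^(-(p-1))`, and taking the root of order `β` gives the exponent. -/
theorem exists_lifespan_le_of_subcritical {N : ℕ} (hN : 1 ≤ N) {m μ ν p R : ℝ} (hm : 0 ≤ m)
    (hμ : 0 ≤ μ) (hδ : 0 ≤ discr μ ν) (hp : 1 < p) (hR : 0 < R) {u₀ u₁ : L2 N}
    (hdata : AdmissibleData μ ν R u₀ u₁)
    (hk : ((1 + m) * ((N : ℝ) - 1) - m + μ) * (p - 1) < 2) :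
    ∃ C : ℝ, 0 < C ∧ ∀ ε : ℝ, 0 < ε → ε ≤ 1 → lifespan m μ ν p R ε u₀ u₁ ≤
      ((C * ε ^ (-(2 * (p - 1) / (2 - ((1 + m) * ((N : ℝ) - 1) - m + μ) * (p - 1)))) : ℝ) :
        EReal) := by
  obtain ⟨T₀, hT₀, K, hK, h⟩ := exists_integral_bound_of_energySolution hN hm hμ hδ hp hR hdata
  set k := ((1 + m) * ((N : ℝ) - 1) - m + μ) * (p - 1) with hkdef
  set β := 1 - k / 2 with hβ
  have hβ0 : 0 < β := by simp only [hβ]; linarith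
  have hT₀0 : 0 < T₀ := by linarith
  set C₀ := T₀ ^ β + β * K with hC₀
  have hC₀0 : 0 < C₀ := by positivity
  have hexp : 2 * (p - 1) / (2 - k) = (p - 1) * (1 / β) := by
    have : 2 - k = 2 * β := by simp only [hβ]; ring
    rw [this]; field_simp
  have hCT : T₀ ≤ C₀ ^ (1 / β) := by
    calc T₀ = (T₀ ^ β) ^ (1 / β) := by rw [← Real.rpow_mul hT₀0.le]; field_simp; simp
      _ ≤ C₀ ^ (1 / β) := by
        refine Real.rpow_le_rpow (by positivity) ?_ (by positivity)
        have : 0 ≤ β * K := by positivity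
        linarith
  refine ⟨C₀ ^ (1 / β), by positivity, fun ε hε hε1 => ?_⟩
  rw [hexp]
  have hp1 : 0 ≤ p - 1 := by linarith
  refine lifespan_le_of_forall (T₀ := T₀) (hCT.trans (le_mul_of_one_le_right (by positivity)
    (one_le_rpow_neg hε hε1 (by positivity)))) fun T u hu hc t₁ ht₁ hT => ?_
  have key := h ε hε T u hu hc t₁ ht₁ hT
  rw [integral_rpow (Or.inl (by simp only [hβ] at hβ0; linarith)),
    show -(k / 2) + 1 = β by simp only [hβ]; ring, div_le_iff₀ hβ0] at key
  have hone := one_le_rpow_neg hε hε1 hp1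
  have ht0 : 0 < t₁ := hT₀0.trans ht₁
  have h1 : t₁ ^ β ≤ C₀ * ε ^ (-(p - 1)) := by
    have : T₀ ^ β ≤ T₀ ^ β * ε ^ (-(p - 1)) := le_mul_of_one_le_right (by positivity) hone
    rw [hC₀]; linarith
  calc t₁ = (t₁ ^ β) ^ (1 / β) := by rw [← Real.rpow_mul ht0.le]; field_simp; simp
    _ ≤ (C₀ * ε ^ (-(p - 1))) ^ (1 / β) := Real.rpow_le_rpow (by positivity) h1 (by positivity)
    _ = _ := by
      rw [Real.mul_rpow hC₀0.le (by positivity), ← Real.rpow_mul hε.le]; congr 2; ring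

/-- Here the integrand is `1/s`, so the bound controls `log t₁ - log T₀`; `log T₀` is absorbed
because `ε ≤ 1`. -/
theorem exists_lifespan_le_of_critical {N : ℕ} (hN : 1 ≤ N) {m μ ν p R : ℝ} (hm : 0 ≤ m)
    (hμ : 0 ≤ μ) (hδ : 0 ≤ discr μ ν) (hp : 1 < p) (hR : 0 < R) {u₀ u₁ : L2 N}
    (hdata : AdmissibleData μ ν R u₀ u₁)
    (hk : ((1 + m) * ((N : ℝ) - 1) - m + μ) * (p - 1) = 2) :
    ∃ C : ℝ, 0 < C ∧ ∀ ε : ℝ, 0 < ε → ε ≤ 1 → lifespan m μ ν p R ε u₀ u₁ ≤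
      ((Real.exp (C * ε ^ (-(p - 1))) : ℝ) : EReal) := by
  obtain ⟨T₀, hT₀, K, hK, h⟩ := exists_integral_bound_of_energySolution hN hm hμ hδ hp hR hdata
  have hT₀0 : 0 < T₀ := by linarith
  have hlog : 0 ≤ Real.log T₀ := Real.log_nonneg hT₀
  refine ⟨Real.log T₀ + K, by positivity, fun ε hε hε1 => ?_⟩
  have hone := one_le_rpow_neg hε hε1 (by linarith : 0 ≤ p - 1)
  have h2 : Real.log T₀ ≤ Real.log T₀ * ε ^ (-(p - 1)) := le_mul_of_one_le_right hlog hone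
  have h3 : 0 < K * ε ^ (-(p - 1)) := by positivity
  refine lifespan_le_of_forall (T₀ := T₀) ?_ fun T u hu hc t₁ ht₁ hT => ?_
  · rw [← Real.log_le_iff_le_exp hT₀0]
    linarith
  · have key := h ε hε T u hu hc t₁ ht₁ hT
    have ht0 : 0 < t₁ := hT₀0.trans ht₁
    rw [hk, div_self two_ne_zero] at key
    simp only [Real.rpow_neg_one] at key
    rw [integral_inv_of_pos hT₀0 ht0, Real.log_div ht0.ne' hT₀0.ne'] at key
    rw [← Real.log_le_iff_le_exp ht0]
    linarith

end TricomiWave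

theorem theorem1 (N : ℕ) (hN : 1 ≤ N) (m μ ν p R : ℝ) (hm : 0 ≤ m) (hμ : 0 ≤ μ)
    (hδ : 0 ≤ TricomiWave.discr μ ν) (hp : 1 < p) (hR : 0 < R)
    (u₀ u₁ : TricomiWave.L2 N) (hdata : TricomiWave.AdmissibleData μ ν R u₀ u₁) :
    ∃ ε₀ : ℝ, 0 < ε₀ ∧ ∃ C : ℝ, 0 < C ∧ ∀ ε : ℝ, 0 < ε → ε ≤ ε₀ →
      (2 ≤ N →
        (p < TricomiWave.pT (N + μ / (m + 1)) m →
          TricomiWave.lifespan m μ ν p R ε u₀ u₁ ≤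
            ((C * ε ^ (-(2 * (p - 1) /
              (2 - ((1 + m) * ((N : ℝ) - 1) - m + μ) * (p - 1)))) : ℝ) : EReal)) ∧
        (p = TricomiWave.pT (N + μ / (m + 1)) m →
          TricomiWave.lifespan m μ ν p R ε u₀ u₁ ≤
            ((Real.exp (C * ε ^ (-(p - 1))) : ℝ) : EReal))) ∧
      (N = 1 →
        ((μ ≤ m ∨ (m < μ ∧ p < 1 + 2 / (μ - m))) →
          TricomiWave.lifespan m μ ν p R ε u₀ u₁ ≤
            ((C * ε ^ (-(2 * (p - 1) / (2 - (μ - m) * (p - 1)))) : ℝ) : EReal)) ∧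
        ((m < μ ∧ p = 1 + 2 / (μ - m)) →
          TricomiWave.lifespan m μ ν p R ε u₀ u₁ ≤
            ((Real.exp (C * ε ^ (-(p - 1))) : ℝ) : EReal))) := by
  set k := (1 + m) * ((N : ℝ) - 1) - m + μ with hk
  have hp1 : 0 < p - 1 := by linarith
  have hpT : TricomiWave.pT (N + μ / (m + 1)) m = 1 + 2 / k := by
    have : (1 + m) * ((N : ℝ) + μ / (m + 1) - 1) - m = k := by
      have : m + 1 ≠ 0 := by positivity
      rw [hk]; field_simp; ring
    rw [TricomiWave.pT, this]
  have hk2 : 2 ≤ N → 0 < k := fun h => by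
    have : (2 : ℝ) ≤ N := by exact_mod_cast h
    nlinarith
  have hk1 : N = 1 → k = μ - m := fun h => by
    rw [hk, h]; push_cast; ring
  have hsub : ∀ q : ℝ, 0 < q → p < 1 + 2 / q → q * (p - 1) < 2 := fun q hq h => by
    have : p - 1 < 2 / q := by linarith
    rw [lt_div_iff₀ hq] at this; linarith
  have hcrit : ∀ q : ℝ, 0 < q → p = 1 + 2 / q → q * (p - 1) = 2 := fun q hq h => by
    rw [h]; field_simp; ring
  have hle : μ ≤ m → (μ - m) * (p - 1) < 2 := fun h => by nlinarith
  -- Every case depends only on `k (p-1)` compared with 2: for `N ≥ 2`, `k > 0` and the threshold is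
  -- `1 + 2/k`; for `N = 1`, `k = μ - m`, and `μ ≤ m` is always subcritical. When `k (p-1) > 2`
  -- nothing is claimed, so any constants serve.
  rcases lt_trichotomy (k * (p - 1)) 2 with h | h | h
  · obtain ⟨C, hC, hbound⟩ :=
      TricomiWave.exists_lifespan_le_of_subcritical hN hm hμ hδ hp hR hdata h
    refine ⟨1, one_pos, C, hC, fun ε hε hε1 => ⟨fun h2 => ⟨fun _ => hbound ε hε hε1, fun h3 => ?_⟩,
      fun h1 => ⟨fun _ => ?_, fun h3 => ?_⟩⟩⟩
    · exact absurd (hcrit k (hk2 h2) (h3.trans hpT)) h.ne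
    · rw [← hk1 h1]; exact hbound ε hε hε1
    · rw [hk1 h1] at h
      exact absurd (hcrit _ (sub_pos.2 h3.1) h3.2) h.ne
  · obtain ⟨C, hC, hbound⟩ :=
      TricomiWave.exists_lifespan_le_of_critical hN hm hμ hδ hp hR hdata h
    refine ⟨1, one_pos, C, hC, fun ε hε hε1 => ⟨fun h2 => ⟨fun h3 => ?_, fun _ => hbound ε hε hε1⟩,
      fun h1 => ⟨fun h3 => ?_, fun _ => hbound ε hε hε1⟩⟩⟩
    · exact absurd h (hsub k (hk2 h2) (hpT ▸ h3)).ne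
    · rw [hk1 h1] at h
      rcases h3 with h3 | h3
      · exact absurd h (hle h3).ne
      · exact absurd h (hsub _ (sub_pos.2 h3.1) h3.2).ne
  · refine ⟨1, one_pos, 1, one_pos, fun ε hε hε1 => ⟨fun h2 => ⟨fun h3 => ?_, fun h3 => ?_⟩,
      fun h1 => ⟨fun h3 => ?_, fun h3 => ?_⟩⟩⟩
    · exact absurd h (hsub k (hk2 h2) (hpT ▸ h3)).not_gt
    · exact absurd (hcrit k (hk2 h2) (h3.trans hpT)) h.ne'
    · rw [hk1 h1] at h
      rcases h3 with h3 | h3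
      · exact absurd h (hle h3).not_gt
      · exact absurd h (hsub _ (sub_pos.2 h3.1) h3.2).not_gt
    · rw [hk1 h1] at h
      exact absurd (hcrit _ (sub_pos.2 h3.1) h3.2) h.ne'
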